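/- **Definitions.** Let $\Sigma$ be the set of linear maps $\mu:\mathbb C[X]\to\mathbb C$ with $\mu(1)=1$, let $m_n(\mu)=\mu(X^n)$, and let $\Sigma_1^\times=\{\mu\in\Sigma:\mu(X)=1\}$. A non-commutative probability space is a unital $\mathbb C$-algebra $\mathcal A$ with a linear map $\phi:\mathcal A\to\mathbb C$, $\phi(1)=1$; the distribution $\mu_a\in\Sigma$ of $a\in\mathcal A$ is $\mu_a(X^n)=\phi(a^n)$. Elements $a,b\in\mathcal A$ are free if $\phi(c_1\cdots c_n)=0$ whenever $n\ge 1$, $\phi(c_j)=0$ for all $j$, and the $c_j$ lie alternately in the unital subalgebra generated by $a$ and in the one generated by $b$. For $\mu,\nu\in\Sigma$, the free convolutions $\mu\boxplus\nu$ and $\mu\boxtimes\nu$ are the distributions of $a+b$ and of $ab$, where $a,b$ are free with $\mu_a=\mu$, $\mu_b=\nu$. Compositional inverses being denoted by $(\,\cdot\,)^{-1}$, put $S(\mu)(z)=\frac{1+z}{z}M_\mu^{-1}(z)$ for $\mu\in\Sigma_1^\times$, where $M_\mu(z)=\sum_{n\ge1}m_n(\mu)z^n$, and $R(\mu)(z)=z\,(G_\mu^{-1}(z)-\tfrac1z)$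 for $\mu\in\Sigma$, where $G_\mu(z)=\sum_{n\ge0}m_n(\mu)z^{-n-1}$. These are bijections $S:\Sigma_1^\times\to 1+z\mathbb C[[z]]$ and $R:\Sigma\to z\mathbb C[[z]]$. Let $\Lambda(\mathbb C)=1+z\mathbb C[[z]]$. For $f,g\in\Lambda(\mathbb C)$ with formal factorisations $f=\prod_i(1-\xi_iz)^{-1}$, $g=\prod_j(1-\eta_jz)^{-1}$ put $f\ast g=\prod_{i,j}(1-\xi_i\eta_jz)^{-1}$; that is, for every $n$, finite factorisations of $f$ and $g$ modulo $z^{n+1}$ give $f\ast g$ modulo $z^{n+1}$. The ghost ring is $z\mathbb C[[z]]$ with coefficientwise addition and multiplication. Let $$\operatorname{LOG}=R^{-1}\circ\Big(z\frac{d}{dz}\log\Big)\circ S:\Sigma_1^\times\to\Sigma,\qquad \operatorname{EXP}=S^{-1}\circ\Big(\sum_{n\ge1}x_nz^n\mapsto\exp\sum_{n\ge1}\frac{x_n}{n}z^n\Big)\circ R:\Sigma\to\Sigma_1^\times .$$ **Theorem.** The free convolutions $\boxplus,\boxtimes$ are well defined on $\Sigma$: every pair of distributions is realised by a free pair, and for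 free $a,b$ in any non-commutative probability space $\mu_{a+b}=\mu_a\boxplus\mu_b$ and $\mu_{ab}=\mu_a\boxtimes\mu_b$. The product $\ast$ is well defined: finite factorisations modulo $z^{n+1}$ exist for every $f\in\Lambda(\mathbb C)$, and $f\ast g$ modulo $z^{n+1}$ does not depend on their choice. Moreover: 1. $\Lambda(\mathbb C)$, with the multiplication of power series as addition and with $\ast$ as multiplication, is a commutative unital ring. 2. $\Sigma_1^\times$, with addition $\boxtimes$ and multiplication $\mu_1\circledast\mu_2:=S^{-1}(S(\mu_1)\ast S(\mu_2))$, is a commutative unital ring, and $S:(\Sigma_1^\times,\boxtimes,\circledast)\to(\Lambda(\mathbb C),\cdot,\ast)$ is a ring isomorphism. 3. $\Sigma$, with addition $\boxplus$ and multiplication $\mu\boxdot\nu:=R^{-1}(R(\mu)\,R(\nu))$ (product in the ghost ring), is a commutative unital ring, and $R$ is a ring isomorphism from $(\Sigma,\boxplus,\boxdot)$ onto the ghost ring $z\mathbb C[[z]]$. 4. $\operatorname{LOG}:(\Sigma_1^\times,\boxtimes,\circledast)\to(\Sigma,\boxplus,\boxdot)$ is a ring isomorphism with inverse $\operatorname{EXP}$.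 -/

import Mathlib

open PowerSeries

noncomputable section

namespace FreeProb

/-! ### Formal power series -/

/-- `f(z) / z` for a series `f` without constant term. -/
def shift (f : ℂ⟦X⟧) : ℂ⟦X⟧ := PowerSeries.mk fun n => coeff (n + 1) f

/-- The inverse with respect to composition of a series `f(z) = c z + ⋯` with `c ≠ 0`
(and `0` if `c = 0`). -/
def compInv (f : ℂ⟦X⟧) : ℂ⟦X⟧ :=
  open Classical in if h : IsUnit (coeff 1 f) then f.substInvOfIsUnit h else 0

theorem X_mul_shift {f : ℂ⟦X⟧} (h : constantCoeff f = 0) : X * shift f = f := by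
  ext n
  cases n with
  | zero => simpa using h.symm
  | succ n => rw [coeff_succ_X_mul]; simp [shift]

theorem shift_X_mul (f : ℂ⟦X⟧) : shift (X * f) = f := by
  ext n
  simp [shift, coeff_succ_X_mul]

theorem constantCoeff_shift (f : ℂ⟦X⟧) : constantCoeff (shift f) = coeff 1 f := by
  rw [← coeff_zero_eq_constantCoeff_apply]; simp [shift]

theorem constantCoeff_compInv (f : ℂ⟦X⟧) : constantCoeff (compInv f) = 0 := by
  unfold compInv
  split_ifs with h
  · simp
  · simp

theorem coeff_one_compInv {f : ℂ⟦X⟧} (h : coeff 1 f = 1) : coeff 1 (compInv f) = 1 := by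
  have hu : IsUnit (coeff 1 f) := by simp [h]
  rw [compInv, dif_pos hu, coeff_one_substInvOfIsUnit]
  have : (hu.unit : ℂ) = 1 := by simp [h]
  rw [Units.val_inv_eq_inv_val, this, inv_one]

theorem subst_compInv {f : ℂ⟦X⟧} (h₀ : constantCoeff f = 0) (h₁ : coeff 1 f = 1) :
    f.subst (compInv f) = X := by
  have hu : IsUnit (coeff 1 f) := by simp [h₁]
  rw [compInv, dif_pos hu]
  exact subst_substInvOfIsUnit_right f h₀ hu

theorem hasSubst_compInv (f : ℂ⟦X⟧) : HasSubst (compInv f) :=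
  HasSubst.of_constantCoeff_zero' (constantCoeff_compInv f)

theorem eq_of_subst_eq_X {K : Type*} [CommRing K] {f g k : K⟦X⟧} (hg : HasSubst g)
    (hk : HasSubst k) (e₁ : f.subst g = X) (e₂ : g.subst k = X) : k = f := by
  have e₃ := subst_comp_subst_apply hg hk f
  rw [e₁, e₂] at e₃
  exact (subst_X hk).symm.trans (e₃.trans (X_subst f))

theorem compInv_compInv {f : ℂ⟦X⟧} (h₀ : constantCoeff f = 0) (h₁ : coeff 1 f = 1) :
    compInv (compInv f) = f :=
  eq_of_subst_eq_X (hasSubst_compInv f) (hasSubst_compInv (compInv f)) (subst_compInv h₀ h₁)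
    (subst_compInv (constantCoeff_compInv f) (coeff_one_compInv h₁))

theorem inv_inv_of_constantCoeff {f : ℂ⟦X⟧} (h : constantCoeff f = 1) : f⁻¹⁻¹ = f := by
  symm
  rw [PowerSeries.eq_inv_iff_mul_eq_one (by simp [h])]
  exact PowerSeries.mul_inv_cancel _ (by simp [h])

/-! ### The set `Λ(ℂ) = 1 + zℂ[[z]]` and its multiplication `∗` -/

/-- `Λ(ℂ) = 1 + zℂ[[z]]`. -/
def Lam : Type := {f : ℂ⟦X⟧ // constantCoeff f = 1}

/-- The product `∏ᵢ (1 - ξᵢ z)⁻¹` over a finite family of complex numbers. -/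
def eulerProd (s : Multiset ℂ) : ℂ⟦X⟧ := (s.map fun ξ => (1 - C ξ * X : ℂ⟦X⟧)⁻¹).prod

/-- The family of all products `ξᵢ ηⱼ`. -/
def pairProducts (s t : Multiset ℂ) : Multiset ℂ := (s ×ˢ t).map fun p => p.1 * p.2

/-- The numbers `ξ₁, …, ξₙ` in the factorisation `f(z) = ∏ᵢ (1 - ξᵢ z)⁻¹` modulo `zⁿ⁺¹`: if
`1 / f = 1 + c₁ z + ⋯ + cₙ zⁿ` modulo `zⁿ⁺¹`, they are the roots of `zⁿ + c₁ zⁿ⁻¹ + ⋯ + cₙ`. -/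
def formalRoots (n : ℕ) (f : ℂ⟦X⟧) : Multiset ℂ := ((trunc (n + 1) f⁻¹).reflect n).roots

theorem constantCoeff_eulerProd (s : Multiset ℂ) : constantCoeff (eulerProd s) = 1 := by
  rw [eulerProd, map_multiset_prod, Multiset.map_map]
  refine Multiset.prod_eq_one fun x hx => ?_
  obtain ⟨ξ, -, rfl⟩ := Multiset.mem_map.1 hx
  simp

/-- `f ∗ g`: if `f = ∏ᵢ (1 - ξᵢ z)⁻¹` and `g = ∏ⱼ (1 - ηⱼ z)⁻¹` modulo `zⁿ⁺¹`, then the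
coefficient of `zⁿ` in `f ∗ g` is the one in `∏ᵢⱼ (1 - ξᵢ ηⱼ z)⁻¹`. -/
def Lam.star (f g : Lam) : Lam :=
  ⟨PowerSeries.mk fun n =>
      coeff n (eulerProd (pairProducts (formalRoots n f.1) (formalRoots n g.1))), by
    rw [← coeff_zero_eq_constantCoeff_apply, coeff_mk, coeff_zero_eq_constantCoeff_apply,
      constantCoeff_eulerProd]⟩

/-! ### The ghost ring `zℂ[[z]]` -/

/-- The set `zℂ[[z]]`. -/
def Ghost : Type := {f : ℂ⟦X⟧ // constantCoeff f = 0}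

/-- The ghost vector `(x₁, x₂, …)` corresponds to the series `∑_{n ≥ 1} xₙ zⁿ`. -/
def ghostEquiv : Ghost ≃ (ℕ+ → ℂ) where
  toFun f n := coeff (n : ℕ) f.1
  invFun x := ⟨PowerSeries.mk fun n => if h : 0 < n then x ⟨n, h⟩ else 0, by
    rw [← coeff_zero_eq_constantCoeff_apply]; simp⟩
  left_inv f := by
    apply Subtype.ext
    ext n
    rw [coeff_mk]
    split_ifs with h
    · rfl
    · obtain rfl : n = 0 := by omega
      rw [coeff_zero_eq_constantCoeff_apply, f.2]
  right_inv x := by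
    funext n
    change coeff (n : ℕ) (PowerSeries.mk fun n => if h : 0 < n then x ⟨n, h⟩ else 0) = x n
    rw [coeff_mk, dif_pos n.pos]
    rfl

/-- The ghost ring: addition and multiplication are coefficientwise, as for ghost vectors. -/
instance : CommRing Ghost := ghostEquiv.commRing

theorem Ghost.coe_add (f g : Ghost) : (f + g).1 = f.1 + g.1 := by
  ext n
  rcases Nat.eq_zero_or_pos n with rfl | h
  · rw [coeff_zero_eq_constantCoeff_apply, coeff_zero_eq_constantCoeff_apply, (f + g).2, map_add,
      f.2, g.2, add_zero]
  · exact congrFun (ghostEquiv.apply_symm_apply (ghostEquiv f + ghostEquiv g)) ⟨n, h⟩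

theorem Ghost.coeff_mul (f g : Ghost) (n : ℕ) :
    coeff n (f * g).1 = coeff n f.1 * coeff n g.1 := by
  rcases Nat.eq_zero_or_pos n with rfl | h
  · rw [coeff_zero_eq_constantCoeff_apply, coeff_zero_eq_constantCoeff_apply, (f * g).2, f.2,
      zero_mul]
  · exact congrFun (ghostEquiv.apply_symm_apply (ghostEquiv f * ghostEquiv g)) ⟨n, h⟩

/-- `f ↦ z (d/dz) log f`. -/
def zdLog (f : Lam) : Ghost := ⟨X * d⁄dX ℂ (logOf f.1), by simp⟩

/-- `∑ xₙ zⁿ ↦ exp (∑ (xₙ / n) zⁿ)`. -/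
def zdExp (x : Ghost) : Lam :=
  ⟨(PowerSeries.exp ℂ).subst (PowerSeries.mk fun n => coeff n x.1 / (n : ℂ)), by
    have h : constantCoeff (PowerSeries.mk fun n => coeff n x.1 / (n : ℂ)) = 0 := by
      rw [← coeff_zero_eq_constantCoeff_apply]; simp
    have hs : HasSubst (PowerSeries.mk fun n => coeff n x.1 / (n : ℂ)) :=
      HasSubst.of_constantCoeff_zero' h
    have h₁ : (PowerSeries.exp ℂ) = (PowerSeries.exp ℂ - 1) + 1 := by ring
    have h₂ : (1 : ℂ⟦X⟧).subst (PowerSeries.mk fun n => coeff n x.1 / (n : ℂ)) = (1 : ℂ⟦X⟧) := by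
      rw [← coe_substAlgHom hs, map_one]
    rw [h₁, subst_add hs, map_add, h₂, map_one]
    have := constantCoeff_subst_eq_zero (a := PowerSeries.mk fun n => coeff n x.1 / (n : ℂ)) h
      (PowerSeries.exp ℂ - 1) (by simp)
    rw [constantCoeff_eq, this, zero_add]⟩

/-! ### Distributions -/

/-- `Σ`: the linear functionals `μ : ℂ[X] → ℂ` with `μ(1) = 1`. -/
@[ext] structure Law where
  toLin : Polynomial ℂ →ₗ[ℂ] ℂ
  map_one : toLin 1 = 1

/-- The moments `mₙ(μ) = μ(Xⁿ)`. -/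
def Law.moment (μ : Law) (n : ℕ) : ℂ := μ.toLin (Polynomial.X ^ n)

/-- `Σ₁ˣ`: the distributions `μ` with mean `μ(X) = 1`. -/
def MeanOneLaw : Type := {μ : Law // μ.toLin Polynomial.X = 1}

/-- The distribution with given moments. -/
def Law.ofMoments (m : ℕ → ℂ) (h : m 0 = 1) : Law where
  toLin := (Polynomial.basisMonomials ℂ).constr ℂ m
  map_one := by
    have := (Polynomial.basisMonomials ℂ).constr_basis ℂ m 0
    simpa [h] using this

theorem Law.moment_ofMoments (m : ℕ → ℂ) (h : m 0 = 1) (n : ℕ) :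
    (Law.ofMoments m h).moment n = m n := by
  have := (Polynomial.basisMonomials ℂ).constr_basis ℂ m n
  rw [Polynomial.coe_basisMonomials] at this
  rw [Law.moment, Polynomial.X_pow_eq_monomial]
  exact this

theorem Law.moment_zero (μ : Law) : μ.moment 0 = 1 := by simp [Law.moment, μ.map_one]

theorem Law.ext_moment {μ ν : Law} (h : ∀ n, μ.moment n = ν.moment n) : μ = ν := by
  apply Law.ext
  refine (Polynomial.basisMonomials ℂ).ext fun n => ?_
  simpa [Law.moment, Polynomial.X_pow_eq_monomial] using h n

instance : Nonempty Law := ⟨Law.ofMoments (fun _ => 1) rfl⟩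

/-! ### Non-commutative probability spaces, freeness and free convolution -/

/-- The functional of a non-commutative probability space with underlying unital algebra `A`. -/
structure NCProb (A : Type*) [Ring A] [Algebra ℂ A] where
  φ : A →ₗ[ℂ] ℂ
  map_one : φ 1 = 1

section
variable {A : Type*} [Ring A] [Algebra ℂ A]

/-- The distribution `Xⁿ ↦ φ(aⁿ)` of a random variable `a`. -/
def NCProb.law (P : NCProb A) (a : A) : Law where
  toLin := P.φ ∘ₗ (Polynomial.aeval a).toLinearMap
  map_one := by simp [P.map_one]

/-- Freeness of a family of unital subalgebras: `φ(a₁ a₂ ⋯ aₙ) = 0` for all `n ≥ 1` whenever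
`aⱼ ∈ A_{iⱼ}` with consecutive indices distinct and `φ(aⱼ) = 0` for all `j`. -/
def NCProb.IsFree (P : NCProb A) {ι : Type*} (B : ι → Subalgebra ℂ A) : Prop :=
  ∀ l : List (ι × A), l ≠ [] → l.IsChain (fun p q => p.1 ≠ q.1) →
    (∀ p ∈ l, p.2 ∈ B p.1 ∧ P.φ p.2 = 0) → P.φ (l.map Prod.snd).prod = 0

/-- Freeness of the pair `a, b`, i.e. of the subalgebras generated by `1, a` and by `1, b`. -/
def NCProb.IsFreePair (P : NCProb A) (a b : A) : Prop :=
  P.IsFree ![Algebra.adjoin ℂ {a}, Algebra.adjoin ℂ {b}]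

end

/-- `μ ⊞ ν`: the distribution of `a + b` for free random variables `a, b` with
distributions `μ, ν`. -/
def freeAddConv (μ ν : Law) : Law :=
  Classical.epsilon fun ρ => ∃ (A : Type) (_ : Ring A) (_ : Algebra ℂ A) (P : NCProb A) (a b : A),
    P.IsFreePair a b ∧ P.law a = μ ∧ P.law b = ν ∧ P.law (a + b) = ρ

/-- `μ ⊠ ν`: the distribution of `a b` for free random variables `a, b` with
distributions `μ, ν`. -/
def freeMulConv (μ ν : Law) : Law :=
  Classical.epsilon fun ρ => ∃ (A : Type) (_ : Ring A) (_ : Algebra ℂ A) (P : NCProb A) (a b : A),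
    P.IsFreePair a b ∧ P.law a = μ ∧ P.law b = ν ∧ P.law (a * b) = ρ

/-! ### The `S`-transform -/

/-- The moment series `M_μ(z) = ∑_{n ≥ 1} mₙ(μ) zⁿ`. -/
def momentSeries (μ : Law) : ℂ⟦X⟧ := PowerSeries.mk fun n => if n = 0 then 0 else μ.moment n

/-- `S_μ(z) = ((1 + z) / z) M_μ⁻¹(z)`, for `μ` with non-zero mean. -/
def sTransform (μ : Law) : ℂ⟦X⟧ := (1 + X) * shift (compInv (momentSeries μ))

theorem constantCoeff_momentSeries (μ : Law) : constantCoeff (momentSeries μ) = 0 := by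
  rw [← coeff_zero_eq_constantCoeff_apply]; simp [momentSeries]

theorem coeff_one_momentSeries (μ : MeanOneLaw) : coeff 1 (momentSeries μ.1) = 1 := by
  simpa [momentSeries, Law.moment] using μ.2

/-- The mean-one distribution with moment series `M`. -/
def ofMomentSeries (M : ℂ⟦X⟧) (h : coeff 1 M = 1) : MeanOneLaw :=
  ⟨Law.ofMoments (fun n => if n = 0 then 1 else coeff n M) rfl, by
    have := Law.moment_ofMoments (fun n => if n = 0 then 1 else coeff n M) rfl 1
    simpa [Law.moment, h] using this⟩

theorem one_add_X_mul_inv : (1 + X : ℂ⟦X⟧) * (1 + X)⁻¹ = 1 :=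
  PowerSeries.mul_inv_cancel _ (by simp)

theorem coeff_one_sInv (f : Lam) : coeff 1 (X * ((1 + X : ℂ⟦X⟧)⁻¹ * f.1)) = 1 := by
  have := coeff_succ_X_mul 0 ((1 + X : ℂ⟦X⟧)⁻¹ * f.1)
  rw [zero_add] at this
  rw [this, coeff_zero_eq_constantCoeff_apply, map_mul, f.2]
  simp

/-- The `S`-transform as a bijection `Σ₁ˣ → Λ(ℂ)`. -/
def sEquiv : MeanOneLaw ≃ Lam where
  toFun μ := ⟨sTransform μ.1, by
    simp [sTransform, constantCoeff_shift, coeff_one_compInv (coeff_one_momentSeries μ)]⟩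
  invFun f := ofMomentSeries (compInv (X * ((1 + X)⁻¹ * f.1))) (coeff_one_compInv (coeff_one_sInv f))
  left_inv μ := by
    apply Subtype.ext
    apply Law.ext_moment
    intro n
    have h : X * ((1 + X : ℂ⟦X⟧)⁻¹ * sTransform μ.1) = compInv (momentSeries μ.1) := by
      rw [sTransform, ← mul_assoc (1 + X)⁻¹, mul_comm (1 + X)⁻¹, one_add_X_mul_inv, one_mul,
        X_mul_shift (constantCoeff_compInv _)]
    simp only [ofMomentSeries, Law.moment_ofMoments, h]
    rw [compInv_compInv (constantCoeff_momentSeries _) (coeff_one_momentSeries μ)]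
    rcases eq_or_ne n 0 with rfl | hn
    · simp [Law.moment_zero]
    · simp [hn, momentSeries]
  right_inv f := by
    apply Subtype.ext
    have h : momentSeries (ofMomentSeries (compInv (X * ((1 + X)⁻¹ * f.1)))
        (coeff_one_compInv (coeff_one_sInv f))).1 = compInv (X * ((1 + X)⁻¹ * f.1)) := by
      ext n
      simp only [momentSeries, ofMomentSeries, Law.moment_ofMoments, coeff_mk]
      rcases eq_or_ne n 0 with rfl | hn
      · simp [constantCoeff_compInv]
      · simp [hn]
    change sTransform _ = f.1
    rw [sTransform, h, compInv_compInv (by simp) (coeff_one_sInv f), shift_X_mul, ← mul_assoc,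
      one_add_X_mul_inv, one_mul]

/-! ### The `R`-transform -/

/-- The Cauchy transform `G(z) = ∑ₙ mₙ(μ) z⁻⁽ⁿ⁺¹⁾` as a series in `w = 1 / z`. -/
def cauchySeries (μ : Law) : ℂ⟦X⟧ := X * PowerSeries.mk fun n => μ.moment n

/-- `R_μ(z) = z (G⁻¹(z) - 1 / z)`. If `h` is the compositional inverse of the Cauchy transform
as a series in `1 / z`, then `G⁻¹ = 1 / h`, so that `R_μ(z) = (h(z) / z)⁻¹ - 1`. -/
def rTransform (μ : Law) : ℂ⟦X⟧ := (shift (compInv (cauchySeries μ)))⁻¹ - 1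

theorem constantCoeff_cauchySeries (μ : Law) : constantCoeff (cauchySeries μ) = 0 := by
  simp [cauchySeries]

theorem coeff_one_X_mul {f : ℂ⟦X⟧} (h : constantCoeff f = 1) : coeff 1 (X * f) = 1 := by
  have := coeff_succ_X_mul 0 f
  rw [zero_add] at this
  rw [this, coeff_zero_eq_constantCoeff_apply, h]

theorem coeff_one_cauchySeries (μ : Law) : coeff 1 (cauchySeries μ) = 1 :=
  coeff_one_X_mul (by rw [← coeff_zero_eq_constantCoeff_apply, coeff_mk, μ.moment_zero])

theorem constantCoeff_rInv (r : Ghost) : constantCoeff (1 + r.1)⁻¹ = 1 := by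
  rw [PowerSeries.constantCoeff_inv, map_add, r.2]; simp

/-- The `R`-transform as a bijection `Σ → zℂ[[z]]`. -/
def rEquiv : Law ≃ Ghost where
  toFun μ := ⟨rTransform μ, by
    simp [rTransform, PowerSeries.constantCoeff_inv, constantCoeff_shift,
      coeff_one_compInv (coeff_one_cauchySeries μ)]⟩
  invFun r := Law.ofMoments (fun n => coeff (n + 1) (compInv (X * (1 + r.1)⁻¹)))
    (coeff_one_compInv (coeff_one_X_mul (constantCoeff_rInv r)))
  left_inv μ := by
    apply Law.ext_moment
    intro n
    have h₁ : constantCoeff (shift (compInv (cauchySeries μ))) = 1 := by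
      rw [constantCoeff_shift, coeff_one_compInv (coeff_one_cauchySeries μ)]
    have h : X * (1 + rTransform μ)⁻¹ = compInv (cauchySeries μ) := by
      rw [rTransform, add_sub_cancel, inv_inv_of_constantCoeff h₁,
        X_mul_shift (constantCoeff_compInv _)]
    rw [Law.moment_ofMoments]
    simp only [h]
    rw [compInv_compInv (constantCoeff_cauchySeries μ) (coeff_one_cauchySeries μ), cauchySeries,
      coeff_succ_X_mul, coeff_mk]
  right_inv r := by
    apply Subtype.ext
    have h : cauchySeries (Law.ofMoments (fun n => coeff (n + 1) (compInv (X * (1 + r.1)⁻¹)))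
        (coeff_one_compInv (coeff_one_X_mul (constantCoeff_rInv r)))) =
        compInv (X * (1 + r.1)⁻¹) := by
      simp only [cauchySeries, Law.moment_ofMoments]
      exact X_mul_shift (constantCoeff_compInv _)
    change rTransform _ = r.1
    rw [rTransform, h, compInv_compInv (by simp) (coeff_one_X_mul (constantCoeff_rInv r)),
      shift_X_mul, inv_inv_of_constantCoeff (by simp [r.2]), add_sub_cancel_left]

/-! ### The multiplications and the maps `LOG`, `EXP` -/

/-- `μ ⊛ ν = S⁻¹(S(μ) ∗ S(ν))` on `Σ₁ˣ`. -/
def starConv (μ ν : MeanOneLaw) : MeanOneLaw := sEquiv.symm (Lam.star (sEquiv μ) (sEquiv ν))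

/-- `μ ⊡ ν = R⁻¹(R(μ) R(ν))` on `Σ`, with the product of the ghost ring `zℂ[[z]]`. -/
def dotConv (μ ν : Law) : Law := rEquiv.symm (rEquiv μ * rEquiv ν)

/-- `LOG = R⁻¹ ∘ z (d/dz) log ∘ S`. -/
def LOG (μ : MeanOneLaw) : Law := rEquiv.symm (zdLog (sEquiv μ))

/-- `EXP = S⁻¹ ∘ (∑ xₙ zⁿ ↦ exp (∑ (xₙ / n) zⁿ)) ∘ R`. -/
def EXP (ν : Law) : MeanOneLaw := sEquiv.symm (zdExp (rEquiv ν))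

end FreeProb

end

open FreeProb

noncomputable section

namespace FreeProb

/-! ### The logarithmic derivative -/

/-! All ring structures are pulled back from the ghost ring along the bijections z(d/dz)log, S and
R. The ring axioms and the isomorphisms are then automatic; what has to be proved is that the
transported operations are the named ones.

For Λ(ℂ): the logarithmic derivative turns products into sums, and sends ∏(1 - ξz)⁻¹ to the series
of power sums of the ξ. Power sums of the family ξᵢηⱼ are products of power sums, so ∗ is
coefficientwise multiplication of ghost components. Both z(d/dz)log and its inverse respect
congruence modulo zⁿ⁺¹, which gives independence of the factorisation (`star_eq_zdExp`,
`trunc_star`); factorisations exist because ℂ is algebraically closed.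

For Σ: R turns ⊞ into + and S turns ⊠ into the product of series (`rTransform_add`,
`momentSeries_mul`). Resolvents of a and b are normalised so that they are a scalar series plus a
centred part x, resp. y. The resolvent of a + b or of ab then factors through (1 - d·xy)⁻¹ for a
scalar series d. Its geometric expansion consists of alternating centred words, on which φ vanishes
by freeness, apart from the empty word (`series_add_mul_inverse_mul_add`).

The convolutions are well defined because alternating centred words span the free algebra
(`centredSpan_eq_top`), so the marginals determine the joint distribution. Free pairs exist by
letting each variable act on its own letter of a full Fock space (`isFreePair_fockOp`). -/

theorem isUnit_of_constantCoeff_eq_one {f : ℂ⟦X⟧} (h : constantCoeff f = 1) : IsUnit f :=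
  isUnit_iff_constantCoeff.2 (by simp [h])

theorem derivative_logOf_mul {f : ℂ⟦X⟧} (h : constantCoeff f = 1) :
    d⁄dX ℂ (logOf f) * f = d⁄dX ℂ f := by
  have hs : HasSubst (f - 1) := HasSubst.of_constantCoeff_zero' (by simp [h])
  have h₁ : d⁄dX ℂ (log ℂ) * (1 + X) = 1 := by
    rw [deriv_log]
    ext n
    cases n with
    | zero => simp
    | succ n =>
      rw [mul_add, mul_one, map_add, coeff_succ_mul_X, coeff_mk, coeff_mk, coeff_one,
        if_neg n.succ_ne_zero, pow_succ]
      simp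
  have h₂ := congrArg (fun p : ℂ⟦X⟧ => p.subst (f - 1)) h₁
  have h₃ : (1 : ℂ⟦X⟧).subst (f - 1) = (1 : ℂ⟦X⟧) := by rw [← coe_substAlgHom hs, map_one]
  simp only [subst_mul hs, subst_add hs, h₃, subst_X hs, add_sub_cancel] at h₂
  rw [logOf_eq, derivative_subst hs, map_sub, derivative_one, sub_zero, mul_right_comm, h₂, one_mul]

theorem zdLog_mul_self (f : Lam) : (zdLog f).1 * f.1 = X * d⁄dX ℂ f.1 := by
  rw [← derivative_logOf_mul f.2, ← mul_assoc]; rfl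

/-- Since f is a unit, the equation x f = z f′ determines x. The computations of `zdLog` below rest
on it and never return to the logarithm. -/
theorem zdLog_eq_of_mul_eq {f : Lam} {x : ℂ⟦X⟧} (h : x * f.1 = X * d⁄dX ℂ f.1) :
    (zdLog f).1 = x :=
  (isUnit_of_constantCoeff_eq_one f.2).mul_left_injective ((zdLog_mul_self f).trans h.symm)

/-- The product of power series on `Λ(ℂ)`. -/
def Lam.mulSeries (f g : Lam) : Lam := ⟨f.1 * g.1, by rw [map_mul, f.2, g.2, one_mul]⟩

theorem zdLog_mulSeries (f g : Lam) : zdLog (f.mulSeries g) = zdLog f + zdLog g := by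
  apply Subtype.ext
  apply zdLog_eq_of_mul_eq
  change _ * (f.1 * g.1) = X * d⁄dX ℂ (f.1 * g.1)
  rw [Ghost.coe_add, Derivation.leibniz]
  simp only [smul_eq_mul]
  linear_combination g.1 * zdLog_mul_self f + f.1 * zdLog_mul_self g

/-- The derivative loses one power of z and the factor z restores it, so z(d/dz) preserves the ideal
(zⁿ⁺¹); the unit f clears denominators. -/
theorem X_pow_dvd_zdLog_sub {n : ℕ} {f g : Lam} (h : X ^ (n + 1) ∣ f.1 - g.1) :
    X ^ (n + 1) ∣ (zdLog f).1 - (zdLog g).1 := by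
  rw [← (isUnit_of_constantCoeff_eq_one f.2).dvd_mul_right]
  have h₁ : ((zdLog f).1 - (zdLog g).1) * f.1 =
      X * d⁄dX ℂ (f.1 - g.1) - (zdLog g).1 * (f.1 - g.1) := by
    rw [map_sub]
    linear_combination zdLog_mul_self f - zdLog_mul_self g
  rw [h₁]
  refine dvd_sub ?_ (h.mul_left _)
  obtain ⟨q, hq⟩ := h
  rw [hq, Derivation.leibniz, derivative_pow, derivative_X]
  simp only [smul_eq_mul, Nat.add_sub_cancel, mul_one]
  exact ⟨X * d⁄dX ℂ q + q * ((n + 1 : ℕ) : ℂ⟦X⟧), by ring⟩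

/-- Pass to the quotient k = f/g: zk′ = `zdLog k` · k vanishes modulo zⁿ⁺¹, and in characteristic
zero this forces k ≡ 1. -/
theorem X_pow_dvd_sub_of_zdLog {n : ℕ} {f g : Lam}
    (h : X ^ (n + 1) ∣ (zdLog f).1 - (zdLog g).1) : X ^ (n + 1) ∣ f.1 - g.1 := by
  have hg : g.1 * g.1⁻¹ = 1 := PowerSeries.mul_inv_cancel _ (by simp [g.2])
  set k : Lam := ⟨f.1 * g.1⁻¹, by
    rw [map_mul, f.2, PowerSeries.constantCoeff_inv, g.2, inv_one, one_mul]⟩ with hk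
  have hkg : k.mulSeries g = f := Subtype.ext (by
    change f.1 * g.1⁻¹ * g.1 = f.1
    rw [mul_assoc, mul_comm g.1⁻¹, hg, mul_one])
  have hz : (zdLog k).1 = (zdLog f).1 - (zdLog g).1 := by
    rw [← hkg, zdLog_mulSeries, Ghost.coe_add, add_sub_cancel_right]
  have hX : X ^ (n + 1) ∣ X * d⁄dX ℂ k.1 := by
    rw [← zdLog_mul_self, hz]
    exact h.mul_right _
  have h₁ : X ^ (n + 1) ∣ k.1 - 1 := by
    rw [X_pow_dvd_iff] at hX ⊢
    intro m hm
    cases m with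
    | zero => simp [k.2]
    | succ m =>
      have := hX _ hm
      rw [coeff_succ_X_mul, coeff_derivative, mul_eq_zero] at this
      have h₂ : ((m : ℂ) + 1) ≠ 0 := by exact_mod_cast m.succ_ne_zero
      rw [map_sub, this.resolve_right h₂, coeff_one, if_neg m.succ_ne_zero, sub_zero]
  have h₃ : f.1 - g.1 = (k.1 - 1) * g.1 := by
    rw [sub_mul, one_mul]
    exact congrArg (· - g.1) (congrArg Subtype.val hkg).symm
  rw [h₃]
  exact h₁.mul_right _

theorem eq_zero_of_forall_X_pow_dvd {f : ℂ⟦X⟧} (h : ∀ n, X ^ (n + 1) ∣ f) : f = 0 := by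
  ext n
  exact X_pow_dvd_iff.1 (h n) n n.lt_succ_self

theorem zdLog_injective : Function.Injective zdLog := fun f g h =>
  Subtype.ext (sub_eq_zero.1 (eq_zero_of_forall_X_pow_dvd fun n =>
    X_pow_dvd_sub_of_zdLog (by rw [h, sub_self]; exact dvd_zero _)))

theorem zdLog_zdExp (x : Ghost) : zdLog (zdExp x) = x := by
  apply Subtype.ext
  apply zdLog_eq_of_mul_eq
  -- At n = 0 the quotient has denominator 0 and equals 0 by convention, so there is no constant
  -- term.
  have hs : HasSubst (PowerSeries.mk fun n => coeff n x.1 / (n : ℂ)) :=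
    HasSubst.of_constantCoeff_zero' (by rw [← coeff_zero_eq_constantCoeff_apply]; simp)
  have h : X * d⁄dX ℂ (PowerSeries.mk fun n => coeff n x.1 / (n : ℂ)) = x.1 := by
    ext n
    cases n with
    | zero => simpa using x.2.symm
    | succ n =>
      rw [coeff_succ_X_mul, coeff_derivative, coeff_mk]
      have h₂ : ((n : ℂ) + 1) ≠ 0 := by exact_mod_cast n.succ_ne_zero
      push_cast
      field_simp
  simp only [zdExp]
  rw [derivative_subst hs, derivative_exp, mul_left_comm, h, mul_comm]

/-- The bijection `z (d/dz) log : Λ(ℂ) → zℂ[[z]]`. -/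
def zdLogEquiv : Lam ≃ Ghost where
  toFun := zdLog
  invFun := zdExp
  left_inv _ := zdLog_injective (zdLog_zdExp _)
  right_inv := zdLog_zdExp

/-! ### Factorisations -/

theorem trunc_eq_trunc_iff {n : ℕ} {f g : ℂ⟦X⟧} : trunc n f = trunc n g ↔ X ^ n ∣ f - g := by
  rw [X_pow_dvd_iff, Polynomial.ext_iff]
  simp only [coeff_trunc, map_sub, sub_eq_zero]
  refine ⟨fun h m hm => by simpa [hm] using h m, fun h m => ?_⟩
  split_ifs with hm
  exacts [h m hm, rfl]

/-- The product `∏ᵢ (1 - ξᵢ z)⁻¹` as an element of `Λ(ℂ)`. -/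
def eulerLam (s : Multiset ℂ) : Lam := ⟨eulerProd s, constantCoeff_eulerProd s⟩

theorem inv_one_sub_C_mul_X (ξ : ℂ) :
    (1 - C ξ * X : ℂ⟦X⟧)⁻¹ = PowerSeries.mk fun n => ξ ^ n := by
  rw [PowerSeries.inv_eq_iff_mul_eq_one (by simp)]
  ext n
  cases n with
  | zero => simp
  | succ n =>
    rw [mul_sub, mul_one, map_sub, ← mul_assoc, coeff_succ_mul_X, coeff_mul_C, coeff_mk, coeff_mk,
      coeff_one, if_neg n.succ_ne_zero, pow_succ, sub_self]

/-- Each factor contributes ξz/(1 - ξz), a geometric series. Degree 0 is excluded because there the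
power sum is the number of factors. -/
theorem coeff_zdLog_eulerLam (s : Multiset ℂ) {n : ℕ} (hn : n ≠ 0) :
    coeff n (zdLog (eulerLam s)).1 = (s.map (· ^ n)).sum := by
  induction s using Multiset.induction_on with
  | empty =>
    have : (zdLog (eulerLam 0)).1 = 0 := zdLog_eq_of_mul_eq (by simp [eulerLam, eulerProd])
    simp [this]
  | cons ξ s ih =>
    obtain ⟨k, hk⟩ : ∃ k : Lam, k.1 = (1 - C ξ * X : ℂ⟦X⟧)⁻¹ := ⟨⟨_, by simp⟩, rfl⟩
    have h₁ : eulerLam (ξ ::ₘ s) = k.mulSeries (eulerLam s) :=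
      Subtype.ext (by simp [eulerLam, eulerProd, Lam.mulSeries, hk])
    have h₂ : (zdLog k).1 = X * (C ξ * (1 - C ξ * X : ℂ⟦X⟧)⁻¹) := by
      apply zdLog_eq_of_mul_eq
      simp only [hk, derivative_inv', map_sub, derivative_one, Derivation.leibniz, derivative_C,
        derivative_X, smul_eq_mul]
      ring
    obtain ⟨n, rfl⟩ := Nat.exists_eq_succ_of_ne_zero hn
    rw [h₁, zdLog_mulSeries, Ghost.coe_add, map_add, ih, h₂, Nat.succ_eq_add_one,
      coeff_succ_X_mul, coeff_C_mul, inv_one_sub_C_mul_X, coeff_mk, Multiset.map_cons,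
      Multiset.sum_cons, pow_succ']

theorem sum_pow_pairProducts (s t : Multiset ℂ) (n : ℕ) :
    ((pairProducts s t).map (· ^ n)).sum = (s.map (· ^ n)).sum * (t.map (· ^ n)).sum := by
  rw [pairProducts, Multiset.map_map]
  induction s using Multiset.induction_on with
  | empty => simp
  | cons a s ih =>
    rw [Multiset.cons_product, Multiset.map_add, Multiset.sum_add, ih, Multiset.map_map,
      Multiset.map_cons, Multiset.sum_cons, add_mul]
    simp [mul_pow, Multiset.sum_map_mul_left]

theorem zdLog_eulerLam_pairProducts (s t : Multiset ℂ) :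
    zdLog (eulerLam (pairProducts s t)) = zdLog (eulerLam s) * zdLog (eulerLam t) := by
  apply Subtype.ext
  ext n
  rw [Ghost.coeff_mul]
  rcases eq_or_ne n 0 with rfl | hn
  · simp [(zdLog _).2]
  · simp only [coeff_zdLog_eulerLam _ hn, sum_pow_pairProducts]

theorem eulerProd_mul (s : Multiset ℂ) :
    eulerProd s * (s.map fun ξ => (1 - C ξ * X : ℂ⟦X⟧)).prod = 1 := by
  rw [eulerProd, ← Multiset.prod_map_mul]
  refine Multiset.prod_eq_one fun x hx => ?_
  obtain ⟨ξ, -, rfl⟩ := Multiset.mem_map.1 hx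
  exact PowerSeries.inv_mul_cancel _ (by simp)

theorem reverse_prod_X_sub_C (s : Multiset ℂ) :
    (s.map fun ξ => Polynomial.X - Polynomial.C ξ).prod.reverse =
      (s.map fun ξ => 1 - Polynomial.C ξ * Polynomial.X).prod := by
  induction s using Multiset.induction_on with
  | empty => simpa using Polynomial.reverse_C (1 : ℂ)
  | cons ξ s ih =>
    have h : (Polynomial.X - Polynomial.C ξ).reverse = 1 - Polynomial.C ξ * Polynomial.X := by
      rw [Polynomial.reverse, Polynomial.natDegree_X_sub_C, Polynomial.reflect_sub,
        Polynomial.reflect_one_X, Polynomial.reflect_C, pow_one]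
    simp only [Multiset.map_cons, Multiset.prod_cons]
    rw [Polynomial.reverse_mul_of_domain, ih, h]

/-- The truncation has constant term 1, so its reflection is monic of degree exactly n and splits
over ℂ; reversing gives the factors 1 - ξz. If the truncation has degree below n, the missing
factors come from roots ξ = 0 and are trivial. -/
theorem trunc_eq_prod_formalRoots (n : ℕ) (f : Lam) : trunc (n + 1) f.1⁻¹ =
    ((formalRoots n f.1).map fun ξ => 1 - Polynomial.C ξ * Polynomial.X).prod := by
  set q := trunc (n + 1) f.1⁻¹ with hq
  have hq₀ : q.coeff 0 = 1 := by
    rw [hq, coeff_trunc, if_pos n.succ_pos, coeff_zero_eq_constantCoeff_apply,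
      PowerSeries.constantCoeff_inv, f.2, inv_one]
  have hdeg : q.natDegree ≤ n := Nat.lt_succ_iff.1 (natDegree_trunc_lt _ _)
  have hr : (q.reflect n).coeff n = 1 := by
    rw [Polynomial.coeff_reflect, Polynomial.revAt_le le_rfl, Nat.sub_self, hq₀]
  have hd : (q.reflect n).natDegree = n := by
    apply le_antisymm
    · refine Polynomial.natDegree_le_iff_coeff_eq_zero.2 fun m hm => ?_
      rw [Polynomial.coeff_reflect, Polynomial.revAt_eq_self_of_lt hm]
      exact Polynomial.coeff_eq_zero_of_natDegree_lt (hdeg.trans_lt hm)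
    · exact Polynomial.le_natDegree_of_ne_zero (by rw [hr]; exact one_ne_zero)
  have hm : (q.reflect n).Monic := by rw [Polynomial.Monic, Polynomial.leadingCoeff, hd, hr]
  have hs := (IsAlgClosed.splits (q.reflect n)).eq_prod_roots_of_monic hm
  have h₁ : (q.reflect n).reverse = q := by
    rw [Polynomial.reverse, hd, Polynomial.reflect_reflect]
  rw [← h₁, hs, reverse_prod_X_sub_C]
  rfl

theorem X_pow_dvd_sub_eulerProd_formalRoots (n : ℕ) (f : Lam) :
    X ^ (n + 1) ∣ f.1 - eulerProd (formalRoots n f.1) := by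
  set s := formalRoots n f.1 with hs
  set Q := (s.map fun ξ => (1 - C ξ * X : ℂ⟦X⟧)).prod with hQ
  have h₁ : X ^ (n + 1) ∣ f.1⁻¹ - Q := by
    have h : Q = ((trunc (n + 1) f.1⁻¹ : Polynomial ℂ) : ℂ⟦X⟧) := by
      rw [trunc_eq_prod_formalRoots, ← Polynomial.coeToPowerSeries.ringHom_apply,
        map_multiset_prod, Multiset.map_map, hQ]
      refine congrArg Multiset.prod (Multiset.map_congr rfl fun ξ _ => ?_)
      simp
    rw [h, ← trunc_eq_trunc_iff, trunc_trunc]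
  have h₂ : f.1 - eulerProd s = -(f.1⁻¹ - Q) * (f.1 * eulerProd s) := by
    linear_combination f.1 * (-eulerProd_mul s) +
      eulerProd s * PowerSeries.mul_inv_cancel f.1 (by rw [f.2]; exact one_ne_zero)
  rw [h₂]
  exact (dvd_neg.2 h₁).mul_right _

/-- The comparison takes place on ghost components: the congruences pass there, are multiplied
coefficientwise, and are carried back by `X_pow_dvd_sub_of_zdLog`. As s and t are arbitrary, this
contains the independence of the factorisation. -/
theorem X_pow_dvd_zdExp_sub_eulerProd {n : ℕ} {f g : Lam} {s t : Multiset ℂ}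
    (hs : X ^ (n + 1) ∣ f.1 - eulerProd s) (ht : X ^ (n + 1) ∣ g.1 - eulerProd t) :
    X ^ (n + 1) ∣ (zdExp (zdLog f * zdLog g)).1 - eulerProd (pairProducts s t) := by
  refine X_pow_dvd_sub_of_zdLog (g := eulerLam (pairProducts s t)) ?_
  replace hs := X_pow_dvd_zdLog_sub (g := eulerLam s) hs
  replace ht := X_pow_dvd_zdLog_sub (g := eulerLam t) ht
  rw [zdLog_zdExp, zdLog_eulerLam_pairProducts]
  rw [X_pow_dvd_iff] at *
  intro m hm
  have h₁ := sub_eq_zero.1 ((map_sub (coeff m) _ _).symm.trans (hs m hm))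
  have h₂ := sub_eq_zero.1 ((map_sub (coeff m) _ _).symm.trans (ht m hm))
  rw [map_sub, Ghost.coeff_mul, Ghost.coeff_mul, h₁, h₂, sub_self]

/-- `Lam.star` uses a different factorisation for each coefficient; the right-hand side is one
series that all of them approximate. -/
theorem star_eq_zdExp (f g : Lam) : Lam.star f g = zdExp (zdLog f * zdLog g) := by
  apply Subtype.ext
  ext n
  have h := X_pow_dvd_zdExp_sub_eulerProd (X_pow_dvd_sub_eulerProd_formalRoots n f)
    (X_pow_dvd_sub_eulerProd_formalRoots n g)
  have h₁ := X_pow_dvd_iff.1 h n n.lt_succ_self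
  rw [map_sub, sub_eq_zero] at h₁
  rw [h₁, Lam.star, coeff_mk]

theorem exists_trunc_eq_eulerProd (n : ℕ) (f : Lam) :
    ∃ s : Multiset ℂ, trunc (n + 1) f.1 = trunc (n + 1) (eulerProd s) :=
  ⟨_, trunc_eq_trunc_iff.2 (X_pow_dvd_sub_eulerProd_formalRoots n f)⟩

theorem trunc_star {n : ℕ} {f g : Lam} {s t : Multiset ℂ}
    (hs : trunc (n + 1) f.1 = trunc (n + 1) (eulerProd s))
    (ht : trunc (n + 1) g.1 = trunc (n + 1) (eulerProd t)) :
    trunc (n + 1) (Lam.star f g).1 = trunc (n + 1) (eulerProd (pairProducts s t)) := by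
  rw [trunc_eq_trunc_iff] at *
  rw [star_eq_zdExp]
  exact X_pow_dvd_zdExp_sub_eulerProd hs ht

/-! ### Power series over a non-commutative probability space -/

theorem coeff_mul_X_pow_mul_of_lt {R : Type*} [Ring R] {n k : ℕ} (h : k < n)
    (u v : R⟦X⟧) :
    coeff k (u * (X ^ n * v)) = 0 := by
  rw [← mul_assoc, (commute_X_pow u n).eq, mul_assoc, coeff_X_pow_mul', if_neg (not_le.2 h)]

/-- The partial sums of the geometric series, with remainder. -/
theorem eq_geom_sum_add {R : Type*} [Ring R] {s e : R} (h : (1 - s) * e = 1) (n : ℕ) :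
    e = ∑ i ∈ Finset.range n, s ^ i + s ^ n * e := by
  have h₁ : e = 1 + s * e := by rw [sub_mul, one_mul] at h; rw [← h]; abel
  induction n with
  | zero => simp
  | succ n ih =>
    rw [Finset.sum_range_succ, add_assoc, pow_succ, mul_assoc]
    have h₂ : s ^ n * e = s ^ n + s ^ n * (s * e) := by
      nth_rw 1 [h₁]
      rw [mul_add, mul_one]
    rw [← h₂]
    exact ih

theorem exists_two_sided_inverse {R : Type*} [Ring R] {p : R⟦X⟧} (h : constantCoeff p = 1) :
    ∃ q, p * q = 1 ∧ q * p = 1 :=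
  ⟨invOfUnit p 1, mul_invOfUnit p 1 (by simpa using h), invOfUnit_mul p 1 (by simpa using h)⟩

section Series
variable {A : Type*} [Ring A] [Algebra ℂ A]

variable (A) in
/-- The embedding of scalar power series into power series over `A`. -/
def scalar : ℂ⟦X⟧ →+* A⟦X⟧ := PowerSeries.map (algebraMap ℂ A)

theorem coeff_scalar (f : ℂ⟦X⟧) (n : ℕ) : coeff n (scalar A f) = algebraMap ℂ A (coeff n f) :=
  coeff_map _ _ _

theorem scalar_X : scalar A X = X := map_X _

theorem scalar_commute (f : ℂ⟦X⟧) (p : A⟦X⟧) : Commute (scalar A f) p := by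
  ext n
  rw [coeff_mul, coeff_mul, ← Finset.Nat.sum_antidiagonal_swap]
  refine Finset.sum_congr rfl fun q _ => ?_
  rw [coeff_scalar, coeff_scalar]
  exact Algebra.commutes _ _

/-- The coefficientwise extension of the functional to power series. -/
def NCProb.series (P : NCProb A) : A⟦X⟧ →+ ℂ⟦X⟧ where
  toFun p := PowerSeries.mk fun n => P.φ (coeff n p)
  map_zero' := by ext; simp
  map_add' p q := by ext; simp

theorem NCProb.coeff_series (P : NCProb A) (p : A⟦X⟧) (n : ℕ) :
    coeff n (P.series p) = P.φ (coeff n p) :=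
  coeff_mk n fun n => P.φ (coeff n p)

theorem NCProb.series_scalar_mul (P : NCProb A) (f : ℂ⟦X⟧) (p : A⟦X⟧) :
    P.series (scalar A f * p) = f * P.series p := by
  ext n
  rw [P.coeff_series, coeff_mul, coeff_mul, map_sum]
  refine Finset.sum_congr rfl fun q _ => ?_
  rw [coeff_scalar, P.coeff_series, ← Algebra.smul_def, map_smul, smul_eq_mul]

theorem NCProb.series_one (P : NCProb A) : P.series 1 = 1 := by
  ext n
  rw [P.coeff_series, coeff_one, coeff_one]
  split_ifs
  exacts [P.map_one, map_zero _]

theorem coeff_pow_eq_zero {f : ℂ⟦X⟧} (hf : constantCoeff f = 0) {k n : ℕ} (h : k < n) :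
    coeff k (f ^ n) = 0 :=
  X_pow_dvd_iff.1 (pow_dvd_pow_of_dvd (X_dvd_iff.2 hf) n) k h

/-- The coefficients of the resolvent `(1 - f a)⁻¹`. -/
theorem coeff_resolvent {f : ℂ⟦X⟧} (hf : constantCoeff f = 0) {a : A} {r : A⟦X⟧}
    (hr : (1 - scalar A f * C a) * r = 1) (k : ℕ) :
    coeff k r = ∑ n ∈ Finset.range (k + 1), coeff k (f ^ n) • a ^ n := by
  have hpow (n : ℕ) : (scalar A f * C a) ^ n = scalar A (f ^ n) * C (a ^ n) := by
    rw [(scalar_commute f _).mul_pow, map_pow, map_pow]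
  have h₁ := congrArg (coeff k) (eq_geom_sum_add hr (k + 1))
  -- As z divides f, the remainder of the geometric series is divisible by zᵏ⁺¹ and invisible in
  -- degree k.
  obtain ⟨g, hg⟩ := pow_dvd_pow_of_dvd (X_dvd_iff.2 hf) (k + 1)
  have h₂ : coeff k ((scalar A f * C a) ^ (k + 1) * r) = 0 := by
    rw [hpow, hg, map_mul (scalar A), map_pow (scalar A), scalar_X, mul_assoc, mul_assoc,
      ← one_mul (X ^ _ * _)]
    exact coeff_mul_X_pow_mul_of_lt k.lt_succ_self _ _
  rw [map_add, h₂, add_zero, map_sum] at h₁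
  rw [h₁]
  refine Finset.sum_congr rfl fun n _ => ?_
  rw [hpow, coeff_mul_C, coeff_scalar, Algebra.smul_def]

theorem coeff_resolvent_mem {f : ℂ⟦X⟧} (hf : constantCoeff f = 0) {a : A} {r : A⟦X⟧}
    (hr : (1 - scalar A f * C a) * r = 1) (k : ℕ) : coeff k r ∈ Algebra.adjoin ℂ {a} := by
  rw [coeff_resolvent hf hr]
  exact sum_mem fun n _ => Subalgebra.smul_mem _
    (pow_mem (Algebra.subset_adjoin (Set.mem_singleton a)) n) _

theorem NCProb.moment_law (P : NCProb A) (a : A) (n : ℕ) : (P.law a).moment n = P.φ (a ^ n) := by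
  simp [NCProb.law, Law.moment]

/-- The functional maps the resolvent `(1 - f a)⁻¹` to `∑ mₙ(a) fⁿ`. -/
theorem NCProb.series_resolvent (P : NCProb A) {f : ℂ⟦X⟧} (hf : constantCoeff f = 0) {a : A}
    {r : A⟦X⟧} (hr : (1 - scalar A f * C a) * r = 1) :
    P.series r = (PowerSeries.mk fun n => (P.law a).moment n).subst f := by
  ext k
  rw [P.coeff_series, coeff_resolvent hf hr, coeff_subst' (HasSubst.of_constantCoeff_zero' hf),
    finsum_eq_sum_of_support_subset (s := Finset.range (k + 1)), map_sum]
  · refine Finset.sum_congr rfl fun n _ => ?_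
    rw [map_smul, coeff_mk, P.moment_law, smul_eq_mul, smul_eq_mul, mul_comm]
  · intro n hn
    by_contra h
    refine hn ?_
    have : k < n := by simpa using h
    change _ • coeff k (f ^ n) = 0
    rw [coeff_pow_eq_zero hf this, smul_zero]

/-! ### Freeness of power series -/

/-- The list `l₀` collects the coefficients already split off on the left. Each Cauchy product moves
one from the head of `l` to the end of `l₀`, and freeness applies once `l` is empty. -/
theorem NCProb.IsFree.φ_prod_mul_coeff {P : NCProb A} {ι : Type*} {B : ι → Subalgebra ℂ A}
    (hP : P.IsFree B) (l : List (ι × A⟦X⟧))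
    (hl : ∀ q ∈ l, (∀ n, coeff n q.2 ∈ B q.1) ∧ P.series q.2 = 0) :
    ∀ l₀ : List (ι × A), (∀ p ∈ l₀, p.2 ∈ B p.1 ∧ P.φ p.2 = 0) →
      (l₀.map Prod.fst ++ l.map Prod.fst).IsChain (· ≠ ·) →
      l₀.map Prod.fst ++ l.map Prod.fst ≠ [] →
      ∀ n, P.φ ((l₀.map Prod.snd).prod * coeff n (l.map Prod.snd).prod) = 0 := by
  induction l with
  | nil =>
    intro l₀ h₀ hc hne n
    have h := hP l₀ (by rintro rfl; simp at hne)
      (by simpa [List.isChain_map] using hc) h₀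
    rw [List.map_nil, List.prod_nil, coeff_one]
    split_ifs
    · rwa [mul_one]
    · rw [mul_zero, map_zero]
  | cons q l ih =>
    intro l₀ h₀ hc hne n
    rw [List.map_cons, List.prod_cons, coeff_mul, Finset.mul_sum, map_sum]
    refine Finset.sum_eq_zero fun k _ => ?_
    obtain ⟨h₁, h₂⟩ := hl q (List.mem_cons_self ..)
    have := ih (fun p hp => hl p (List.mem_cons_of_mem _ hp)) (l₀ ++ [(q.1, coeff k.1 q.2)]) (by
      intro p hp
      rcases List.mem_append.1 hp with hp | hp
      · exact h₀ p hp
      · obtain rfl := List.mem_singleton.1 hp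
        refine ⟨h₁ _, ?_⟩
        rw [← P.coeff_series, h₂, map_zero]) (by simpa using hc) (by simp) k.2
    rw [← mul_assoc]
    simpa using this

theorem NCProb.IsFree.series_prod {P : NCProb A} {ι : Type*} {B : ι → Subalgebra ℂ A}
    (hP : P.IsFree B) {l : List (ι × A⟦X⟧)} (hne : l ≠ [])
    (hc : l.IsChain (fun p q => p.1 ≠ q.1))
    (hl : ∀ q ∈ l, (∀ n, coeff n q.2 ∈ B q.1) ∧ P.series q.2 = 0) :
    P.series (l.map Prod.snd).prod = 0 := by
  ext n
  have := hP.φ_prod_mul_coeff l hl [] (by simp) (by simpa [List.isChain_map] using hc)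
    (by simpa using hne) n
  rw [P.coeff_series, map_zero]
  simpa using this

/-- The alternating word of length `n` in `z 0`, `z 1` that begins with `z i`. -/
def altWord {M : Type*} (z : Fin 2 → M) : ℕ → Fin 2 → List (Fin 2 × M)
  | 0, _ => []
  | n + 1, i => (i, z i) :: altWord z n (i + 1)

theorem isChain_altWord {M : Type*} (z : Fin 2 → M) (n : ℕ) (i : Fin 2) :
    (altWord z n i).IsChain (fun p q => p.1 ≠ q.1) := by
  induction n generalizing i with
  | zero => exact List.IsChain.nil
  | succ n ih =>
    cases n with
    | zero => exact List.IsChain.singleton _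
    | succ n => exact List.IsChain.cons_cons (by fin_cases i <;> simp) (ih (i + 1))

theorem eq_of_mem_altWord {M : Type*} {z : Fin 2 → M} {n : ℕ} {i : Fin 2} {q : Fin 2 × M}
    (h : q ∈ altWord z n i) : q.2 = z q.1 := by
  induction n generalizing i with
  | zero => simp [altWord] at h
  | succ n ih =>
    rcases List.mem_cons.1 h with rfl | h
    exacts [rfl, ih h]

/-- The product of an alternating word. -/
def altProd {M : Type*} [Monoid M] (z : Fin 2 → M) (n : ℕ) (i : Fin 2) : M :=
  ((altWord z n i).map Prod.snd).prod

theorem altProd_succ {M : Type*} [Monoid M] (z : Fin 2 → M) (n : ℕ) (i : Fin 2) :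
    altProd z (n + 1) i = z i * altProd z n (i + 1) := by
  simp [altProd, altWord]

theorem altProd_even {M : Type*} [Monoid M] (x y : M) (n : ℕ) :
    altProd ![x, y] (2 * n) 0 = (x * y) ^ n := by
  induction n with
  | zero => simp [altProd, altWord]
  | succ n ih =>
    rw [show 2 * (n + 1) = 2 * n + 1 + 1 by ring, altProd_succ, altProd_succ, pow_succ', mul_assoc]
    -- The index 0 + 1 + 1 reduces to 0 in `Fin 2`.
    exact congrArg (fun w => x * (y * w)) ih

theorem altProd_odd {M : Type*} [Monoid M] (x y : M) (n : ℕ) :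
    altProd ![x, y] (2 * n + 1) 0 = (x * y) ^ n * x := by
  induction n with
  | zero => simp [altProd, altWord]
  | succ n ih =>
    rw [show 2 * (n + 1) + 1 = 2 * n + 1 + 1 + 1 by ring, altProd_succ, altProd_succ, pow_succ',
      mul_assoc, mul_assoc]
    exact congrArg (fun w => x * (y * w)) ih

/-! ### The resolvent of a product of two centred free series -/

section Centred
variable {P : NCProb A} {B : Fin 2 → Subalgebra ℂ A} {x y : A⟦X⟧}

theorem NCProb.IsFree.series_altProd (hP : P.IsFree B) (hx : ∀ n, coeff n x ∈ B 0)
    (hy : ∀ n, coeff n y ∈ B 1) (hx₀ : P.series x = 0) (hy₀ : P.series y = 0) (n : ℕ)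
    (i : Fin 2) : P.series (altProd ![x, y] (n + 1) i) = 0 := by
  refine hP.series_prod (by simp [altWord]) (isChain_altWord _ _ _) fun q hq => ?_
  rw [eq_of_mem_altWord hq]
  generalize q.1 = j
  fin_cases j
  exacts [⟨hx, hx₀⟩, ⟨hy, hy₀⟩]

/-- Only the first term of the geometric series of `(1 - d x y)⁻¹` contributes. -/
theorem NCProb.series_mul_mul {d : ℂ⟦X⟧} {e u v : A⟦X⟧}
    (hs : constantCoeff (scalar A d * (x * y)) = 0) (he : (1 - scalar A d * (x * y)) * e = 1)
    (h : ∀ n, P.series (u * ((x * y) ^ (n + 1) * v)) = 0) :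
    P.series (u * (e * v)) = P.series (u * v) := by
  ext k
  have h₁ : u * (e * v) = ∑ i ∈ Finset.range (k + 1), u * ((scalar A d * (x * y)) ^ i * v) +
      u * ((scalar A d * (x * y)) ^ (k + 1) * (e * v)) := by
    rw [← Finset.mul_sum, ← Finset.sum_mul, ← mul_add, ← mul_assoc (_ ^ (k + 1)) e v, ← add_mul,
      ← eq_geom_sum_add he (k + 1)]
  have h₂ : coeff k (u * ((scalar A d * (x * y)) ^ (k + 1) * (e * v))) = 0 := by
    obtain ⟨w, hw⟩ := X_dvd_iff.2 hs
    rw [hw, (commute_X w).symm.mul_pow, mul_assoc]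
    exact coeff_mul_X_pow_mul_of_lt k.lt_succ_self _ _
  rw [P.coeff_series, h₁, map_add, h₂, add_zero, ← P.coeff_series, map_sum,
    Finset.sum_range_succ', Finset.sum_eq_zero, zero_add, pow_zero, one_mul]
  intro i _
  rw [(scalar_commute d _).mul_pow, ← map_pow, mul_assoc, ← mul_assoc u,
    ← (scalar_commute (d ^ (i + 1)) u).eq, mul_assoc, P.series_scalar_mul, h, mul_zero]

/-- The common core of the additive and the multiplicative case. With y to the left of e = (1 -
d·xy)⁻¹ and x to its right, all words (xy)ⁿ, y(xy)ⁿ, (xy)ⁿx and y(xy)ⁿx alternate. Only the empty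
word has non-zero expectation, with coefficient f². -/
theorem NCProb.IsFree.series_add_mul_inverse_mul_add (hP : P.IsFree B)
    (hx : ∀ n, coeff n x ∈ B 0) (hy : ∀ n, coeff n y ∈ B 1) (hx₀ : P.series x = 0)
    (hy₀ : P.series y = 0) {d : ℂ⟦X⟧} {e : A⟦X⟧}
    (hs : constantCoeff (scalar A d * (x * y)) = 0) (he : (1 - scalar A d * (x * y)) * e = 1)
    (f g : ℂ⟦X⟧) :
    P.series ((scalar A f + scalar A g * y) * (e * (scalar A f + scalar A g * x))) = f * f := by
  have halt := hP.series_altProd hx hy hx₀ hy₀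
  have h₁ : P.series (1 * (e * 1)) = 1 := by
    rw [P.series_mul_mul hs he, mul_one, P.series_one]
    intro n
    rw [one_mul, mul_one, ← altProd_even]
    exact halt _ _
  have h₂ : P.series (y * (e * 1)) = 0 := by
    rw [P.series_mul_mul hs he, mul_one, hy₀]
    intro n
    rw [mul_one, ← altProd_even]
    have := halt (2 * (n + 1)) 1
    rwa [altProd_succ] at this
  have h₃ : P.series (1 * (e * x)) = 0 := by
    rw [P.series_mul_mul hs he, one_mul, hx₀]
    intro n
    rw [one_mul, ← altProd_odd]
    exact halt _ _
  have h₄ : P.series (y * (e * x)) = 0 := by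
    have hyx (n : ℕ) : P.series (y * ((x * y) ^ n * x)) = 0 := by
      have := halt (2 * n + 1) 1
      rw [altProd_succ] at this
      rw [← altProd_odd]
      exact this
    rw [P.series_mul_mul hs he fun n => hyx _]
    simpa using hyx 0
  have h₅ : (scalar A f + scalar A g * y) * (e * (scalar A f + scalar A g * x)) =
      scalar A (f * f) * (1 * (e * 1)) + scalar A (g * f) * (y * (e * 1)) +
        scalar A (f * g) * (1 * (e * x)) + scalar A (g * g) * (y * (e * x)) := by
    have c₁ : e * scalar A f = scalar A f * e := (scalar_commute f e).eq.symm
    have c₂ : e * scalar A g = scalar A g * e := (scalar_commute g e).eq.symm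
    have c₃ : y * scalar A f = scalar A f * y := (scalar_commute f y).eq.symm
    have c₄ : y * scalar A g = scalar A g * y := (scalar_commute g y).eq.symm
    simp only [map_mul, mul_one, one_mul]
    rw [mul_add e, ← mul_assoc e, c₁, c₂, add_mul, mul_add, mul_add]
    simp only [mul_assoc]
    rw [← mul_assoc y (scalar A f), c₃, ← mul_assoc y (scalar A g), c₄]
    simp only [mul_assoc]
    abel
  rw [h₅]
  simp only [map_add, P.series_scalar_mul, h₁, h₂, h₃, h₄]
  ring

end Centred

end Series

/-! ### Additivity of `R` and multiplicativity of `S` -/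

theorem subst_cauchySeries (μ : Law) {k : ℂ⟦X⟧} (hk : constantCoeff k = 0) :
    (cauchySeries μ).subst k = k * (PowerSeries.mk fun n => μ.moment n).subst k := by
  have hs : HasSubst k := HasSubst.of_constantCoeff_zero' hk
  rw [cauchySeries, subst_mul hs, subst_X hs]

theorem one_add_subst_momentSeries (μ : Law) {k : ℂ⟦X⟧} (hk : constantCoeff k = 0) :
    1 + (momentSeries μ).subst k = (PowerSeries.mk fun n => μ.moment n).subst k := by
  have hs : HasSubst k := HasSubst.of_constantCoeff_zero' hk
  have h₁ : (PowerSeries.mk fun n => μ.moment n) = 1 + momentSeries μ := by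
    ext n
    rw [map_add, coeff_one, momentSeries, coeff_mk, coeff_mk]
    split_ifs with h
    · rw [h, μ.moment_zero, add_zero]
    · rw [zero_add]
  have h₂ : (1 : ℂ⟦X⟧).subst k = (1 : ℂ⟦X⟧) := by rw [← coe_substAlgHom hs, _root_.map_one]
  rw [h₁, subst_add hs, h₂]

theorem eq_compInv_of_subst_eq_X {f k : ℂ⟦X⟧} (h₀ : constantCoeff f = 0) (h₁ : coeff 1 f = 1)
    (hk : constantCoeff k = 0) (h : f.subst k = X) : k = compInv f := by
  have h₂ := subst_compInv (constantCoeff_compInv f) (coeff_one_compInv h₁)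
  rw [compInv_compInv h₀ h₁] at h₂
  exact eq_of_subst_eq_X (HasSubst.of_constantCoeff_zero' h₀) (HasSubst.of_constantCoeff_zero' hk)
    h₂ h

theorem X_mul_cancel {f g : ℂ⟦X⟧} (h : X * f = X * g) : f = g :=
  mul_left_cancel₀ X_ne_zero h

section
variable {A : Type*} [Ring A] [Algebra ℂ A]

theorem sub_X_mul_C_eq {f : ℂ⟦X⟧} (hf : constantCoeff f = 1) (a : A) :
    scalar A f - X * C a = scalar A f * (1 - scalar A (X * f⁻¹) * C a) := by
  have h : f * (X * f⁻¹) = X := by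
    rw [mul_left_comm, PowerSeries.mul_inv_cancel _ (by simp [hf]), mul_one]
  rw [mul_sub, mul_one, ← mul_assoc, ← map_mul, h, scalar_X]

theorem inverse_sub_X_mul_C {f : ℂ⟦X⟧} (hf : constantCoeff f = 1) {a : A} {t : A⟦X⟧}
    (ht : (scalar A f - X * C a) * t = 1) :
    (1 - scalar A (X * f⁻¹) * C a) * (scalar A f * t) = 1 := by
  rw [← mul_assoc, ← (scalar_commute f _).eq, ← sub_X_mul_C_eq hf, ht]

/-- Put ζ = f/z. Then f - za = z(ζ - a), so zt is the resolvent of a at ζ, and φ of it is the Cauchy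
transform there, written in the variable 1/ζ = z/f. -/
theorem NCProb.subst_cauchySeries_eq (P : NCProb A) {f : ℂ⟦X⟧} (hf : constantCoeff f = 1) {a : A}
    {t : A⟦X⟧} (ht : (scalar A f - X * C a) * t = 1) :
    (cauchySeries (P.law a)).subst (X * f⁻¹) = X * P.series t := by
  have h₀ : constantCoeff (X * f⁻¹) = 0 := by simp
  rw [subst_cauchySeries _ h₀, ← P.series_resolvent h₀ (inverse_sub_X_mul_C hf ht),
    P.series_scalar_mul, ← mul_assoc, mul_assoc X, PowerSeries.inv_mul_cancel _ (by simp [hf]),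
    mul_one]

theorem constantCoeff_one_add_rTransform (μ : Law) : constantCoeff (1 + rTransform μ) = 1 := by
  rw [map_add, _root_.map_one]
  exact add_eq_left.2 (rEquiv μ).2

theorem X_mul_inv_one_add_rTransform (μ : Law) :
    X * (1 + rTransform μ)⁻¹ = compInv (cauchySeries μ) := by
  rw [rTransform, add_sub_cancel, inv_inv_of_constantCoeff, X_mul_shift (constantCoeff_compInv _)]
  rw [constantCoeff_shift, coeff_one_compInv (coeff_one_cauchySeries μ)]

/-- By `subst_cauchySeries_eq`, φ(t) = 1 means that z/f inverts the Cauchy series. One direction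
makes t - 1 centred for a and b separately; the other recognises the R-transform of a + b. -/
theorem NCProb.series_inverse_eq_one_iff (P : NCProb A) {f : ℂ⟦X⟧} (hf : constantCoeff f = 1)
    {a : A} {t : A⟦X⟧} (ht : (scalar A f - X * C a) * t = 1) :
    P.series t = 1 ↔ f = 1 + rTransform (P.law a) := by
  have hc := P.subst_cauchySeries_eq hf ht
  constructor
  · intro h
    rw [h, mul_one] at hc
    have h₁ := eq_compInv_of_subst_eq_X (constantCoeff_cauchySeries _)
      (coeff_one_cauchySeries _) (by simp) hc
    rw [← X_mul_inv_one_add_rTransform] at h₁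
    rw [← inv_inv_of_constantCoeff hf, X_mul_cancel h₁,
      inv_inv_of_constantCoeff (constantCoeff_one_add_rTransform _)]
  · rintro rfl
    rw [X_mul_inv_one_add_rTransform,
      subst_compInv (constantCoeff_cauchySeries _) (coeff_one_cauchySeries _)] at hc
    exact X_mul_cancel (by rw [← hc, mul_one])

theorem coeff_inverse_mem {f : ℂ⟦X⟧} (hf : constantCoeff f = 1) {a : A} {t : A⟦X⟧}
    (ht : (scalar A f - X * C a) * t = 1) (n : ℕ) : coeff n t ∈ Algebra.adjoin ℂ {a} := by
  have h : t = scalar A f⁻¹ * (scalar A f * t) := by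
    rw [← mul_assoc, ← map_mul, PowerSeries.inv_mul_cancel _ (by simp [hf]), _root_.map_one, one_mul]
  rw [h, coeff_mul]
  refine sum_mem fun q _ => ?_
  rw [coeff_scalar, ← Algebra.smul_def]
  exact Subalgebra.smul_mem _
    (coeff_resolvent_mem (by simp) (inverse_sub_X_mul_C hf ht) _) _

theorem coeff_one_mem (S : Subalgebra ℂ A) (n : ℕ) : coeff n (1 : A⟦X⟧) ∈ S := by
  rw [coeff_one]
  split_ifs
  exacts [one_mem S, zero_mem S]

theorem NCProb.IsFreePair.rTransform_add {P : NCProb A} {a b : A} (h : P.IsFreePair a b) :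
    rTransform (P.law (a + b)) = rTransform (P.law a) + rTransform (P.law b) := by
  set f := 1 + rTransform (P.law a) with hf
  set g := 1 + rTransform (P.law b) with hg
  have hf₁ : constantCoeff f = 1 := constantCoeff_one_add_rTransform _
  have hg₁ : constantCoeff g = 1 := constantCoeff_one_add_rTransform _
  have hsc {k : ℂ⟦X⟧} (hk : constantCoeff k = 1) (c : A) :
      constantCoeff (scalar A k - X * C c) = 1 := by
    rw [map_sub, map_mul, constantCoeff_X, zero_mul, sub_zero,
      ← coeff_zero_eq_constantCoeff_apply, coeff_scalar, coeff_zero_eq_constantCoeff_apply, hk,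
      _root_.map_one]
  have hfg₁ : constantCoeff (f + g - 1) = 1 := by simp [hf₁, hg₁]
  obtain ⟨s, hs, hs'⟩ := exists_two_sided_inverse (hsc hf₁ a)
  obtain ⟨t, ht, ht'⟩ := exists_two_sided_inverse (hsc hg₁ b)
  have hs₀ : constantCoeff s = 1 := by
    have := congrArg constantCoeff hs
    rwa [map_mul, hsc hf₁, one_mul, _root_.map_one] at this
  have hx₀ : P.series (s - 1) = 0 := by
    rw [map_sub, (P.series_inverse_eq_one_iff hf₁ hs).2 hf, P.series_one, sub_self]
  have hy₀ : P.series (t - 1) = 0 := by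
    rw [map_sub, (P.series_inverse_eq_one_iff hg₁ ht).2 hg, P.series_one, sub_self]
  have hd : constantCoeff (scalar A 1 * ((s - 1) * (t - 1))) = 0 := by
    rw [_root_.map_one, one_mul, map_mul, map_sub, hs₀, _root_.map_one, sub_self, zero_mul]
  obtain ⟨e, he, -⟩ := exists_two_sided_inverse
    (p := 1 - scalar A 1 * ((s - 1) * (t - 1))) (by rw [map_sub, hd, _root_.map_one, sub_zero])
  have hser := h.series_add_mul_inverse_mul_add (x := s - 1) (y := t - 1)
    (fun n => by
      rw [map_sub]; exact sub_mem (coeff_inverse_mem hf₁ hs n) (coeff_one_mem _ n))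
    (fun n => by
      rw [map_sub]; exact sub_mem (coeff_inverse_mem hg₁ ht n) (coeff_one_mem _ n))
    hx₀ hy₀ hd he 1 1
  rw [_root_.map_one, one_mul, one_mul, add_sub_cancel, add_sub_cancel, mul_one] at hser
  -- With p = f - za = s⁻¹ and q = g - zb = t⁻¹ the left side is p + q - 1 = pq - (1 - p)(1 - q),
  -- and 1 - p = p(s - 1), 1 - q = (t - 1)q. Hence its inverse is t e s, with t = 1 + y and s = 1 +
  -- x as the core lemma requires.
  have hT : scalar A (f + g - 1) - X * C (a + b) = (scalar A f - X * C a) *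
      (1 - scalar A 1 * ((s - 1) * (t - 1))) * (scalar A g - X * C b) := by
    set p := scalar A f - X * C a
    set q := scalar A g - X * C b
    have h₁ : scalar A (f + g - 1) - X * C (a + b) = p + q - 1 := by
      simp only [p, q, map_add, map_sub, _root_.map_one, mul_add]
      abel
    have h₂ : p * (1 - scalar A 1 * ((s - 1) * (t - 1))) * q =
        p * q - (p * s - p) * (t * q - q) := by
      rw [_root_.map_one]
      noncomm_ring
    rw [h₁, h₂, hs, ht']
    noncomm_ring
  have hinv : (scalar A (f + g - 1) - X * C (a + b)) * (t * (e * s)) = 1 := by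
    rw [hT]
    set p := scalar A f - X * C a
    set q := scalar A g - X * C b
    rw [mul_assoc _ q, ← mul_assoc q, ht, one_mul, mul_assoc p, ← mul_assoc _ e, he, one_mul, hs]
  have := (P.series_inverse_eq_one_iff hfg₁ hinv).1 hser
  rw [hf, hg] at this
  linear_combination -this

theorem NCProb.IsFreePair.subst_momentSeries_mul {P : NCProb A} {a b : A}
    (h : P.IsFreePair a b) (ha : P.φ a = 1) (hb : P.φ b = 1) :
    (momentSeries (P.law (a * b))).subst
      (X * ((1 + X) * (shift (compInv (momentSeries (P.law a))) *
        shift (compInv (momentSeries (P.law b)))))) = X := by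
  have hone {c : A} (hc : P.φ c = 1) : coeff 1 (momentSeries (P.law c)) = 1 := by
    simp [momentSeries, P.moment_law, hc]
  -- The resolvent r of c at M⁻¹(z) satisfies φ(r) = 1 + M(M⁻¹(z)) = 1 + z. Writing M⁻¹(z)c = zw
  -- gives r = 1 + z(wr), hence φ(wr) = 1, and y = wr - 1 is the centred part. The coefficients of
  -- wr are those of r shifted by one, so they lie in the algebra of c.
  have key {c : A} (hc : P.φ c = 1) : ∃ r y : A⟦X⟧,
      (1 - X * (scalar A (shift (compInv (momentSeries (P.law c)))) * C c)) * r = 1 ∧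
      r * (1 - X * (scalar A (shift (compInv (momentSeries (P.law c)))) * C c)) = 1 ∧
      r = 1 + X + X * y ∧
      (scalar A (shift (compInv (momentSeries (P.law c)))) * C c) * r = 1 + y ∧
      r * (scalar A (shift (compInv (momentSeries (P.law c)))) * C c) = 1 + y ∧
      (∀ n, coeff n y ∈ Algebra.adjoin ℂ {c}) ∧ P.series y = 0 := by
    set f := compInv (momentSeries (P.law c)) with hf
    have hf₀ : constantCoeff f = 0 := constantCoeff_compInv _
    set w := scalar A (shift f) * C c with hw
    have hX : X * w = scalar A f * C c := by
      rw [hw, ← mul_assoc, ← scalar_X, ← map_mul, X_mul_shift hf₀]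
    obtain ⟨r, hr, hr'⟩ := exists_two_sided_inverse (p := 1 - X * w) (by simp)
    have hwr : w * r = r * w := by
      have h₁ : w * (1 - X * w) = (1 - X * w) * w := by
        rw [mul_sub, sub_mul, mul_one, one_mul, ← mul_assoc, (commute_X w).eq]
      calc w * r = r * (1 - X * w) * w * r := by rw [hr', one_mul]
        _ = r * (w * (1 - X * w)) * r := by rw [h₁, mul_assoc r]
        _ = r * w := by rw [mul_assoc, mul_assoc, hr, mul_one]
    have hrw : r = 1 + X * (w * r) := by
      rw [sub_mul, one_mul, mul_assoc] at hr
      rw [← hr]; abel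
    have hr₂ : (1 - scalar A f * C c) * r = 1 := by rw [← hX, hr]
    have hmem := coeff_resolvent_mem hf₀ hr₂
    refine ⟨r, w * r - 1, hr, hr', ?_, by abel, by rw [← hwr]; abel, fun n => ?_, ?_⟩
    · rw [mul_sub, mul_one]
      nth_rw 1 [hrw]
      abel
    · have h₁ : coeff n (w * r) = coeff (n + 1) r := by
        nth_rw 2 [hrw]
        rw [map_add, coeff_succ_X_mul, coeff_one, if_neg n.succ_ne_zero, zero_add]
      rw [map_sub, h₁]
      exact sub_mem (hmem _) (coeff_one_mem _ _)
    · have h₁ : P.series r = 1 + X := by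
        rw [P.series_resolvent hf₀ hr₂, ← one_add_subst_momentSeries _ hf₀, hf,
          subst_compInv (constantCoeff_momentSeries _) (hone hc)]
      have h₂ : P.series r = 1 + X * P.series (w * r) := by
        nth_rw 1 [hrw]
        rw [map_add, P.series_one, ← scalar_X, P.series_scalar_mul]
      rw [map_sub, P.series_one, sub_eq_zero]
      apply X_mul_cancel
      rw [mul_one]
      linear_combination h₁ - h₂
  obtain ⟨r, x, hr, hr', hrx, hwr, hrw, hx, hx₀⟩ := key ha
  obtain ⟨t, y, ht, ht', hty, hvt, htv, hy, hy₀⟩ := key hb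
  set F := shift (compInv (momentSeries (P.law a)))
  set G := shift (compInv (momentSeries (P.law b)))
  set d : ℂ⟦X⟧ := X * (1 + X)⁻¹ with hd
  have hd₁ : (1 + X) * d = X := by
    rw [hd, mul_left_comm, one_add_X_mul_inv, mul_one]
  have hdc : constantCoeff (scalar A d * (x * y)) = 0 := by
    rw [hd, map_mul (scalar A), scalar_X, mul_assoc, map_mul, constantCoeff_X, zero_mul]
  obtain ⟨e, he, -⟩ := exists_two_sided_inverse
    (p := 1 - scalar A d * (x * y)) (by rw [map_sub, hdc, _root_.map_one, sub_zero])
  have hser := h.series_add_mul_inverse_mul_add hx hy hx₀ hy₀ hdc he (1 + X) X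
  have hX : scalar A (1 + X) = 1 + X := by rw [map_add, _root_.map_one, scalar_X]
  rw [hX, scalar_X, ← hrx, ← hty] at hser
  set k : ℂ⟦X⟧ := X * ((1 + X) * (F * G)) with hk
  have hk₀ : constantCoeff k = 0 := by simp [hk]
  have hkab : scalar A k * C (a * b) =
      (1 + X) * (X * ((scalar A F * C a) * (scalar A G * C b))) := by
    rw [hk, mul_left_comm, map_mul, hX, map_mul, scalar_X, map_mul, map_mul, mul_assoc, mul_assoc,
      mul_assoc, mul_assoc, ← mul_assoc (C a), ← (scalar_commute G (C a)).eq, mul_assoc]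
  -- Inserting r = 1 + z + zx, t = 1 + z + zy and k = z(1 + z)FG, the terms linear in x and y cancel
  -- and 1 + z - z·xy remains. This is where d = z/(1 + z) comes from.
  have hmid : r * (1 - scalar A k * C (a * b)) * t =
      (1 + X) * (1 - scalar A d * (x * y)) := by
    have c₁ : r * (1 + X) = (1 + X) * r := by rw [← hX, (scalar_commute _ r).eq]
    have c₂ : r * X = X * r := (commute_X r).eq
    have h₁ : r * (scalar A k * C (a * b)) * t = (1 + X) * (X * ((1 + x) * (1 + y))) := by
      rw [hkab, ← hrw, ← hvt, ← mul_assoc r, c₁, mul_assoc (1 + X), ← mul_assoc r, c₂]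
      simp only [mul_assoc]
    have h₂ : (1 + X) * (scalar A d * (x * y)) = X * (x * y) := by
      rw [← mul_assoc, ← hX, ← map_mul, hd₁, scalar_X]
    have c₃ : x * X = X * x := (commute_X x).eq
    rw [mul_sub, sub_mul, mul_one, h₁, mul_sub, mul_one, h₂, hrx, hty]
    have h₃ : (1 + X + X * x) * (1 + X + X * y) =
        (1 + X) * (1 + X) + (1 + X) * (X * y) + X * x + X * (x * X) + X * ((x * X) * y) := by
      noncomm_ring
    rw [h₃, c₃]
    noncomm_ring
  have hinv : (1 - scalar A k * C (a * b)) * (scalar A (1 + X)⁻¹ * (t * (e * r))) = 1 := by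
    have h₁ : (1 - scalar A k * C (a * b)) * t =
        (1 - X * (scalar A F * C a)) * ((1 + X) * (1 - scalar A d * (x * y))) := by
      rw [← hmid, ← mul_assoc, ← mul_assoc, hr, one_mul]
    rw [← mul_assoc, ← (scalar_commute (1 + X)⁻¹ _).eq, mul_assoc, ← mul_assoc _ t, h₁,
      mul_assoc, mul_assoc, ← mul_assoc _ e, he, one_mul, ← hX, ← mul_assoc _ (scalar A (1 + X)),
      ← (scalar_commute (1 + X) _).eq, mul_assoc, hr, mul_one, ← map_mul, mul_comm,
      one_add_X_mul_inv, _root_.map_one]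
  have hfin := one_add_subst_momentSeries (P.law (a * b)) hk₀
  rw [← P.series_resolvent hk₀ hinv, P.series_scalar_mul, hser] at hfin
  linear_combination hfin + (1 + X) * one_add_X_mul_inv

/-- Freeness and mean one: the moment series of `a b` is the inverse of `z S(a) S(b) / (1 + z)`. -/
theorem NCProb.IsFreePair.momentSeries_mul {P : NCProb A} {a b : A}
    (h : P.IsFreePair a b) (ha : P.φ a = 1) (hb : P.φ b = 1) :
    momentSeries (P.law (a * b)) =
      compInv (X * ((1 + X)⁻¹ * (sTransform (P.law a) * sTransform (P.law b)))) := by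
  set F := shift (compInv (momentSeries (P.law a))) with hF
  set G := shift (compInv (momentSeries (P.law b))) with hG
  have hone {c : A} (hc : P.φ c = 1) :
      constantCoeff (shift (compInv (momentSeries (P.law c)))) = 1 := by
    rw [constantCoeff_shift]
    exact coeff_one_compInv (by simp [momentSeries, P.moment_law, hc])
  have hk : X * ((1 + X)⁻¹ * (sTransform (P.law a) * sTransform (P.law b))) =
      X * ((1 + X) * (F * G)) := by
    rw [sTransform, sTransform, ← hF, ← hG]
    linear_combination X * (1 + X) * F * G * one_add_X_mul_inv
  have hk₁ : coeff 1 (X * ((1 + X) * (F * G))) = 1 :=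
    coeff_one_X_mul (by simp [hF, hG, hone ha, hone hb])
  rw [hk]
  symm
  exact eq_of_subst_eq_X (HasSubst.of_constantCoeff_zero' (by simp)) (hasSubst_compInv _)
    (h.subst_momentSeries_mul ha hb) (subst_compInv (by simp) hk₁)

end

/-! ### The joint distribution of free variables is determined by the marginals -/

/-- The product in the free algebra of polynomials in its generators. -/
def wordProd (l : List (Fin 2 × Polynomial ℂ)) : FreeAlgebra ℂ (Fin 2) :=
  (l.map fun p => Polynomial.aeval (FreeAlgebra.ι ℂ p.1) p.2).prod

/-- Alternating words of polynomials that are centred for the given distributions. -/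
def IsCentred (μ : Fin 2 → Law) (l : List (Fin 2 × Polynomial ℂ)) : Prop :=
  l.IsChain (fun p q => p.1 ≠ q.1) ∧ ∀ p ∈ l, (μ p.1).toLin p.2 = 0

/-- The span of the alternating centred words. -/
def centredSpan (μ : Fin 2 → Law) : Submodule ℂ (FreeAlgebra ℂ (Fin 2)) :=
  Submodule.span ℂ (wordProd '' {l | IsCentred μ l})

/-- Split p into its centred part and a constant: the first lengthens the word, the second leaves it
unchanged. -/
theorem aeval_mul_wordProd_mem {μ : Fin 2 → Law} {i : Fin 2} {l : List (Fin 2 × Polynomial ℂ)}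
    (hl : IsCentred μ l) (hi : ∀ q ∈ l.head?, i ≠ q.1) (p : Polynomial ℂ) :
    Polynomial.aeval (FreeAlgebra.ι ℂ i) p * wordProd l ∈ centredSpan μ := by
  set c := (μ i).toLin p with hc
  have h₁ : Polynomial.aeval (FreeAlgebra.ι ℂ i) p * wordProd l =
      wordProd ((i, p - c • (1 : Polynomial ℂ)) :: l) + c • wordProd l := by
    simp only [wordProd, List.map_cons, List.prod_cons, map_sub, map_smul, map_one, sub_mul,
      smul_mul_assoc, one_mul, sub_add_cancel]
  rw [h₁]
  refine add_mem (Submodule.subset_span ⟨_, ⟨List.isChain_cons.2 ⟨hi, hl.1⟩, ?_⟩, rfl⟩)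
    (Submodule.smul_mem _ _ (Submodule.subset_span ⟨_, hl, rfl⟩))
  intro q hq
  rcases List.mem_cons.1 hq with rfl | hq
  · simp [(μ i).map_one, hc]
  · exact hl.2 q hq

/-- If the word already starts with the letter i, the generator is absorbed into its first
polynomial, which is then centred anew. -/
theorem ι_mul_mem_centredSpan {μ : Fin 2 → Law} (i : Fin 2) {w : FreeAlgebra ℂ (Fin 2)}
    (hw : w ∈ centredSpan μ) : FreeAlgebra.ι ℂ i * w ∈ centredSpan μ := by
  induction hw using Submodule.span_induction with
  | zero => rw [mul_zero]; exact zero_mem _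
  | add x y _ _ hx hy => rw [mul_add]; exact add_mem hx hy
  | smul c x _ hx => rw [mul_smul_comm]; exact Submodule.smul_mem _ _ hx
  | mem x hx =>
    obtain ⟨l, hl, rfl⟩ := hx
    by_cases hi : ∀ q ∈ l.head?, i ≠ q.1
    · simpa using aeval_mul_wordProd_mem hl hi Polynomial.X
    · cases l with
      | nil => simp at hi
      | cons q l =>
        obtain ⟨j, p⟩ := q
        obtain rfl : i = j := by simpa using hi
        have hc := List.isChain_cons.1 hl.1
        have := aeval_mul_wordProd_mem (i := i) (l := l) ⟨hc.2, fun q hq =>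
          hl.2 q (List.mem_cons_of_mem _ hq)⟩ hc.1 (Polynomial.X * p)
        simpa [wordProd, mul_assoc] using this

/-- The span is a left ideal and contains 1, the empty word. -/
theorem centredSpan_eq_top (μ : Fin 2 → Law) : centredSpan μ = ⊤ := by
  have h (f : FreeAlgebra ℂ (Fin 2)) : ∀ w ∈ centredSpan μ, f * w ∈ centredSpan μ := by
    induction f using FreeAlgebra.induction with
    | grade0 c => intro w hw; rw [← Algebra.smul_def]; exact Submodule.smul_mem _ _ hw
    | grade1 i => exact fun w hw => ι_mul_mem_centredSpan i hw
    | mul a b ha hb => intro w hw; rw [mul_assoc]; exact ha _ (hb _ hw)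
    | add a b ha hb => intro w hw; rw [add_mul]; exact add_mem (ha _ hw) (hb _ hw)
  refine Submodule.eq_top_iff'.2 fun f => ?_
  have h₁ := h f 1 (Submodule.subset_span ⟨[], ⟨List.IsChain.nil, by simp⟩, by simp [wordProd]⟩)
  rwa [mul_one] at h₁

section
variable {A : Type*} [Ring A] [Algebra ℂ A]

theorem NCProb.IsFreePair.φ_lift_wordProd {P : NCProb A} {a b : A} (h : P.IsFreePair a b)
    {l : List (Fin 2 × Polynomial ℂ)} (hl : IsCentred ![P.law a, P.law b] l) :
    P.φ (FreeAlgebra.lift ℂ ![a, b] (wordProd l)) = if l = [] then 1 else 0 := by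
  have h₁ : FreeAlgebra.lift ℂ ![a, b] (wordProd l) = ((l.map fun p =>
      (p.1, Polynomial.aeval (![a, b] p.1) p.2)).map Prod.snd).prod := by
    rw [wordProd, map_list_prod, List.map_map, List.map_map]
    congr 1
    refine List.map_congr_left fun p _ => ?_
    simp only [Function.comp_apply, ← Polynomial.aeval_algHom_apply, FreeAlgebra.lift_ι_apply]
  rw [h₁]
  split_ifs with hne
  · rw [hne]
    simpa using P.map_one
  · refine h _ (by simpa using hne) (by simpa [List.isChain_map] using hl.1) fun q hq => ?_
    obtain ⟨⟨i, p⟩, hp, rfl⟩ := List.mem_map.1 hq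
    have hp₀ := hl.2 _ hp
    revert hp₀
    fin_cases i
    · exact fun hp₀ => ⟨Polynomial.aeval_mem_adjoin_singleton ℂ a, hp₀⟩
    · exact fun hp₀ => ⟨Polynomial.aeval_mem_adjoin_singleton ℂ b, hp₀⟩

/-- On the spanning set of centred words, freeness forces the value 0, or 1 for the empty word, in
any realisation. -/
theorem NCProb.IsFreePair.φ_lift_eq {A' : Type*} [Ring A'] [Algebra ℂ A'] {P : NCProb A}
    {P' : NCProb A'} {a b : A} {a' b' : A'} (h : P.IsFreePair a b) (h' : P'.IsFreePair a' b')
    (ha : P.law a = P'.law a') (hb : P.law b = P'.law b') (w : FreeAlgebra ℂ (Fin 2)) :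
    P.φ (FreeAlgebra.lift ℂ ![a, b] w) = P'.φ (FreeAlgebra.lift ℂ ![a', b'] w) := by
  have hw : w ∈ centredSpan ![P.law a, P.law b] := by
    rw [centredSpan_eq_top]; exact Submodule.mem_top
  have heq : Set.EqOn (P.φ ∘ₗ (FreeAlgebra.lift ℂ ![a, b]).toLinearMap)
      (P'.φ ∘ₗ (FreeAlgebra.lift ℂ ![a', b']).toLinearMap)
      (wordProd '' {l | IsCentred ![P.law a, P.law b] l}) := by
    rintro _ ⟨l, hl, rfl⟩
    refine (h.φ_lift_wordProd hl).trans (h'.φ_lift_wordProd ?_).symm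
    rwa [← ha, ← hb]
  exact LinearMap.eqOn_span heq hw

theorem NCProb.IsFreePair.law_lift_eq {A' : Type*} [Ring A'] [Algebra ℂ A'] {P : NCProb A}
    {P' : NCProb A'} {a b : A} {a' b' : A'} (h : P.IsFreePair a b) (h' : P'.IsFreePair a' b')
    (ha : P.law a = P'.law a') (hb : P.law b = P'.law b') (w : FreeAlgebra ℂ (Fin 2)) :
    P.law (FreeAlgebra.lift ℂ ![a, b] w) = P'.law (FreeAlgebra.lift ℂ ![a', b'] w) := by
  refine Law.ext_moment fun n => ?_
  rw [P.moment_law, P'.moment_law, ← map_pow, ← map_pow]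
  exact h.φ_lift_eq h' ha hb _

end

/-! ### Existence of free variables with given distributions -/

/-- The `n`-th column, for the basis `1, Xⁿ - mₙ`, of the multiplication by `X` on `ℂ[X]`. -/
def momentColumn (μ : Law) : ℕ → ℕ →₀ ℂ
  | 0 => Finsupp.single 1 1 + μ.moment 1 • Finsupp.single 0 1
  | n + 1 => Finsupp.single (n + 2) 1 + μ.moment (n + 2) • Finsupp.single 0 1 -
      μ.moment (n + 1) • (Finsupp.single 1 1 + μ.moment 1 • Finsupp.single 0 1)

/-- Multiplication by `X` on `ℂ[X]`, in the basis `1, Xⁿ - mₙ`. -/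
def momentOp (μ : Law) : Module.End ℂ (ℕ →₀ ℂ) := Finsupp.linearCombination ℂ (momentColumn μ)

/-- In the chosen basis this reads Xⁿ⁺¹ = (Xⁿ⁺¹ - mₙ₊₁) + mₙ₊₁·1. All basis vectors but 1 are
centred, so μ is the coordinate at 0. -/
theorem momentOp_pow (μ : Law) (n : ℕ) : (momentOp μ ^ (n + 1)) (Finsupp.single 0 1) =
    Finsupp.single (n + 1) 1 + μ.moment (n + 1) • Finsupp.single 0 1 := by
  have h (k : ℕ) : momentOp μ (Finsupp.single k 1) = momentColumn μ k := by simp [momentOp]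
  induction n with
  | zero => rw [zero_add, pow_one, h, momentColumn]
  | succ n ih =>
    rw [pow_succ', Module.End.mul_apply, ih, map_add, map_smul, h, h, momentColumn, momentColumn,
      sub_add_cancel]

theorem momentOp_pow_apply_zero (μ : Law) (n : ℕ) :
    (momentOp μ ^ n) (Finsupp.single 0 1) 0 = μ.moment n := by
  cases n with
  | zero => simp [μ.moment_zero]
  | succ n => simp [momentOp_pow]

/-- The embedding `eₖ ↦ iᵏ w` into the full Fock space with basis the words in two letters. -/
def wordEmb (i : Fin 2) (w : List (Fin 2)) : (ℕ →₀ ℂ) →ₗ[ℂ] (List (Fin 2) →₀ ℂ) :=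
  Finsupp.linearCombination ℂ fun k => Finsupp.single (List.replicate k i ++ w) 1

theorem wordEmb_single (i : Fin 2) (w : List (Fin 2)) (k : ℕ) :
    wordEmb i w (Finsupp.single k 1) = Finsupp.single (List.replicate k i ++ w) 1 := by
  simp [wordEmb]

/-- The operator `iᵏ w ↦ Xᵢ (eₖ) w` on the full Fock space, with `Xᵢ = momentOp μ`. -/
def fockOp (μ : Law) (i : Fin 2) : Module.End ℂ (List (Fin 2) →₀ ℂ) :=
  Finsupp.linearCombination ℂ fun w =>
    wordEmb i (w.dropWhile (· = i)) (momentColumn μ (w.takeWhile (· = i)).length)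

/-- Every word is uniquely iᵏw with w not starting with i, so the Fock space is a direct sum of
copies of ℂ[X] indexed by such w, on each of which `fockOp` is multiplication by X. -/
theorem fockOp_wordEmb (μ : Law) {i : Fin 2} {w : List (Fin 2)} (hw : w.head? ≠ some i)
    (v : ℕ →₀ ℂ) : fockOp μ i (wordEmb i w v) = wordEmb i w (momentOp μ v) := by
  suffices h : fockOp μ i ∘ₗ wordEmb i w = wordEmb i w ∘ₗ momentOp μ from LinearMap.congr_fun h v
  ext1 k
  ext1
  have h₁ : w.takeWhile (· = i) = [] ∧ w.dropWhile (· = i) = w := by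
    cases w with
    | nil => simp
    | cons j w =>
      have : ¬ j = i := by simpa using hw
      simp [this]
  have h₂ : ∀ j ∈ List.replicate k i, decide (j = i) = true := by simp
  simp only [LinearMap.comp_apply, Finsupp.lsingle_apply]
  rw [wordEmb_single, fockOp, Finsupp.linearCombination_single, one_smul,
    List.takeWhile_append_of_pos h₂, List.dropWhile_append_of_pos h₂, h₁.1, h₁.2, List.append_nil,
    List.length_replicate, momentOp, Finsupp.linearCombination_single, one_smul]

theorem aeval_fockOp_wordEmb (μ : Law) {i : Fin 2} {w : List (Fin 2)} (hw : w.head? ≠ some i)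
    (p : Polynomial ℂ) (v : ℕ →₀ ℂ) : Polynomial.aeval (fockOp μ i) p (wordEmb i w v) =
      wordEmb i w (Polynomial.aeval (momentOp μ) p v) := by
  induction p using Polynomial.induction_on' generalizing v with
  | add p q hp hq => simp only [map_add, LinearMap.add_apply, hp, hq]
  | monomial n c =>
    have h : (fockOp μ i ^ n) (wordEmb i w v) = wordEmb i w ((momentOp μ ^ n) v) := by
      induction n with
      | zero => rfl
      | succ n ih =>
        rw [pow_succ', Module.End.mul_apply, ih, fockOp_wordEmb μ hw, pow_succ',
          Module.End.mul_apply]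
    simp only [Polynomial.aeval_monomial, ← Algebra.smul_def, LinearMap.smul_apply, h, map_smul]

/-- The vacuum state on the operators on the full Fock space. -/
def vacuum : NCProb (Module.End ℂ (List (Fin 2) →₀ ℂ)) where
  φ := Finsupp.lapply [] ∘ₗ LinearMap.applyₗ (Finsupp.single [] 1)
  map_one := by simp

theorem vacuum_φ_apply (T : Module.End ℂ (List (Fin 2) →₀ ℂ)) :
    vacuum.φ T = T (Finsupp.single [] 1) [] := rfl

theorem wordEmb_nil_apply_nil (i : Fin 2) (v : ℕ →₀ ℂ) : wordEmb i [] v [] = v 0 := by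
  suffices h : Finsupp.lapply [] ∘ₗ wordEmb i [] = Finsupp.lapply (R := ℂ) (M := ℂ) 0 from
    LinearMap.congr_fun h v
  ext1 k
  ext1
  simp only [LinearMap.comp_apply, Finsupp.lsingle_apply, wordEmb_single, Finsupp.lapply_apply]
  cases k <;> simp [List.replicate_succ]

theorem vacuum_φ_aeval_fockOp (μ : Law) (i : Fin 2) (p : Polynomial ℂ) :
    vacuum.φ (Polynomial.aeval (fockOp μ i) p) =
      Polynomial.aeval (momentOp μ) p (Finsupp.single 0 1) 0 := by
  have := aeval_fockOp_wordEmb μ (i := i) (w := []) (by simp) p (Finsupp.single 0 1)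
  rw [wordEmb_single] at this
  rw [vacuum_φ_apply, ← wordEmb_nil_apply_nil i, ← this]
  rfl

theorem vacuum_law_fockOp (μ : Law) (i : Fin 2) : vacuum.law (fockOp μ i) = μ := by
  refine Law.ext_moment fun n => ?_
  have := vacuum_φ_aeval_fockOp μ i (Polynomial.X ^ n)
  rw [Polynomial.aeval_X_pow, Polynomial.aeval_X_pow, momentOp_pow_apply_zero] at this
  rw [NCProb.moment_law, this]

/-- The span of the words that satisfy a condition. -/
def wordSpan (s : Set (List (Fin 2))) : Submodule ℂ (List (Fin 2) →₀ ℂ) :=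
  Submodule.span ℂ ((fun w => Finsupp.single w 1) '' s)

theorem single_mem_wordSpan {s : Set (List (Fin 2))} {w : List (Fin 2)} (h : w ∈ s) :
    Finsupp.single w 1 ∈ wordSpan s :=
  Submodule.subset_span ⟨w, h, rfl⟩

/-- Starting from w = i⁰w, the coefficient of w itself in the result is the vacuum expectation of
the operator, which is 0. Only words iᵏw with k ≥ 1 remain. -/
theorem aeval_fockOp_mem (μ : Law) (i : Fin 2) {p : Polynomial ℂ}
    (hp : vacuum.φ (Polynomial.aeval (fockOp μ i) p) = 0) {x : List (Fin 2) →₀ ℂ}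
    (hx : x ∈ wordSpan {w | w.head? ≠ some i}) :
    Polynomial.aeval (fockOp μ i) p x ∈ wordSpan {w | w.head? = some i} := by
  induction hx using Submodule.span_induction with
  | zero => rw [map_zero]; exact zero_mem _
  | add x y _ _ hx hy => rw [map_add]; exact add_mem hx hy
  | smul c x _ hx => rw [map_smul]; exact Submodule.smul_mem _ _ hx
  | mem x hx =>
    obtain ⟨w, hw, rfl⟩ := hx
    have h := aeval_fockOp_wordEmb μ hw p (Finsupp.single 0 1)
    rw [wordEmb_single, List.replicate_zero, List.nil_append] at h
    change Polynomial.aeval (fockOp μ i) p (Finsupp.single w 1) ∈ _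
    rw [vacuum_φ_aeval_fockOp] at hp
    rw [h, wordEmb, Finsupp.linearCombination_apply]
    refine Submodule.sum_mem _ fun k hk => Submodule.smul_mem _ _ (single_mem_wordSpan ?_)
    cases k with
    | zero => exact absurd hp (Finsupp.mem_support_iff.1 hk)
    | succ k => simp [List.replicate_succ]

theorem apply_nil_eq_zero {i : Fin 2} {x : List (Fin 2) →₀ ℂ}
    (hx : x ∈ wordSpan {w | w.head? = some i}) : x [] = 0 := by
  induction hx using Submodule.span_induction with
  | zero => rfl
  | add x y _ _ hx hy => rw [Finsupp.add_apply, hx, hy, add_zero]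
  | smul c x _ hx => rw [Finsupp.smul_apply, hx, smul_zero]
  | mem x hx =>
    obtain ⟨w, hw, rfl⟩ := hx
    refine Finsupp.single_eq_of_ne ?_
    rintro rfl
    simp at hw

/-- Reading the product from the right, each centred factor yields words starting with its own
letter, hence not with the letter i of the factor that acts next. -/
theorem prod_vacuum_mem (μ : Fin 2 → Law)
    (l : List (Fin 2 × Module.End ℂ (List (Fin 2) →₀ ℂ)))
    (hc : l.IsChain (fun p q => p.1 ≠ q.1))
    (hl : ∀ q ∈ l, q.2 ∈ Algebra.adjoin ℂ {fockOp (μ q.1) q.1} ∧ vacuum.φ q.2 = 0) :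
    ∀ i, (∀ q ∈ l.head?, i ≠ q.1) →
      (l.map Prod.snd).prod (Finsupp.single [] 1) ∈ wordSpan {w | w.head? ≠ some i} := by
  induction l with
  | nil => exact fun i _ => single_mem_wordSpan (by simp)
  | cons q l ih =>
    intro i hi
    have hc' := List.isChain_cons.1 hc
    have h₁ := ih hc'.2 (fun p hp => hl p (List.mem_cons_of_mem _ hp)) q.1 hc'.1
    obtain ⟨h₂, h₃⟩ := hl q (List.mem_cons_self ..)
    rw [Algebra.adjoin_singleton_eq_range_aeval] at h₂
    obtain ⟨p, hp⟩ := h₂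
    rw [← show _ = q.2 from hp] at h₃
    have h₄ := aeval_fockOp_mem _ _ h₃ h₁
    rw [List.map_cons, List.prod_cons, Module.End.mul_apply, ← show _ = q.2 from hp]
    refine Submodule.span_mono (Set.image_mono fun w hw => ?_) h₄
    rw [Set.mem_ofPred_eq] at hw ⊢
    rw [hw]
    simpa using (hi q (by simp)).symm

theorem isFree_fockOp (μ : Fin 2 → Law) :
    vacuum.IsFree fun i => Algebra.adjoin ℂ {fockOp (μ i) i} := by
  intro l hne hc hl
  cases l with
  | nil => exact absurd rfl hne
  | cons q l =>
    have hc' := List.isChain_cons.1 hc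
    have h₁ := prod_vacuum_mem μ l hc'.2 (fun p hp => hl p (List.mem_cons_of_mem _ hp)) q.1 hc'.1
    obtain ⟨h₂, h₃⟩ := hl q (List.mem_cons_self ..)
    beta_reduce at h₂
    rw [Algebra.adjoin_singleton_eq_range_aeval] at h₂
    obtain ⟨p, hp⟩ := h₂
    rw [← show _ = q.2 from hp] at h₃
    rw [List.map_cons, List.prod_cons, vacuum_φ_apply, Module.End.mul_apply,
      ← show _ = q.2 from hp]
    exact apply_nil_eq_zero (aeval_fockOp_mem _ _ h₃ h₁)

theorem isFreePair_fockOp (μ ν : Law) : vacuum.IsFreePair (fockOp μ 0) (fockOp ν 1) := by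
  have h : (fun i => Algebra.adjoin ℂ {fockOp (![μ, ν] i) i}) =
      ![Algebra.adjoin ℂ {fockOp μ 0}, Algebra.adjoin ℂ {fockOp ν 1}] := by
    funext i
    fin_cases i <;> rfl
  rw [NCProb.IsFreePair, ← h]
  exact isFree_fockOp _

/-! ### The free convolutions -/

theorem exists_isFreePair (μ ν : Law) : ∃ (A : Type) (_ : Ring A) (_ : Algebra ℂ A)
    (P : NCProb A) (a b : A), P.IsFreePair a b ∧ P.law a = μ ∧ P.law b = ν :=
  ⟨_, _, _, vacuum, fockOp μ 0, fockOp ν 1, isFreePair_fockOp μ ν, vacuum_law_fockOp μ 0,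
    vacuum_law_fockOp ν 1⟩

section
variable {A : Type*} [Ring A] [Algebra ℂ A]

/-- `freeAddConv` selects the law coming from some realisation in `Type`, which exists by
`exists_isFreePair`; uniqueness of the joint distribution transfers it to free pairs in any
universe. -/
theorem NCProb.IsFreePair.law_add {P : NCProb A} {a b : A} (h : P.IsFreePair a b) :
    P.law (a + b) = freeAddConv (P.law a) (P.law b) := by
  obtain ⟨A', _, _, P', a', b', h', ha, hb⟩ := exists_isFreePair (P.law a) (P.law b)
  obtain ⟨A'', _, _, P'', a'', b'', h'', ha', hb', hρ⟩ := Classical.epsilon_spec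
    (p := fun ρ => ∃ (A' : Type) (_ : Ring A') (_ : Algebra ℂ A') (P' : NCProb A') (a' b' : A'),
      P'.IsFreePair a' b' ∧ P'.law a' = P.law a ∧ P'.law b' = P.law b ∧ P'.law (a' + b') = ρ)
    ⟨_, A', _, _, P', a', b', h', ha, hb, rfl⟩
  rw [freeAddConv, ← hρ]
  have := h.law_lift_eq h'' ha'.symm hb'.symm (FreeAlgebra.ι ℂ 0 + FreeAlgebra.ι ℂ 1)
  rw [map_add, map_add] at this
  simp only [FreeAlgebra.lift_ι_apply] at this
  exact this

theorem NCProb.IsFreePair.law_mul {P : NCProb A} {a b : A} (h : P.IsFreePair a b) :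
    P.law (a * b) = freeMulConv (P.law a) (P.law b) := by
  obtain ⟨A', _, _, P', a', b', h', ha, hb⟩ := exists_isFreePair (P.law a) (P.law b)
  obtain ⟨A'', _, _, P'', a'', b'', h'', ha', hb', hρ⟩ := Classical.epsilon_spec
    (p := fun ρ => ∃ (A' : Type) (_ : Ring A') (_ : Algebra ℂ A') (P' : NCProb A') (a' b' : A'),
      P'.IsFreePair a' b' ∧ P'.law a' = P.law a ∧ P'.law b' = P.law b ∧ P'.law (a' * b') = ρ)
    ⟨_, A', _, _, P', a', b', h', ha, hb, rfl⟩
  rw [freeMulConv, ← hρ]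
  have := h.law_lift_eq h'' ha'.symm hb'.symm (FreeAlgebra.ι ℂ 0 * FreeAlgebra.ι ℂ 1)
  rw [map_mul, map_mul] at this
  simp only [FreeAlgebra.lift_ι_apply] at this
  exact this

end

theorem rEquiv_freeAddConv (μ ν : Law) : rEquiv (freeAddConv μ ν) = rEquiv μ + rEquiv ν := by
  obtain ⟨A, _, _, P, a, b, h, rfl, rfl⟩ := exists_isFreePair μ ν
  apply Subtype.ext
  rw [← h.law_add, Ghost.coe_add]
  exact h.rTransform_add

/-- Stated through S⁻¹, the identity also shows that ⊠ preserves mean one, which is not known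
beforehand. -/
theorem sEquiv_symm_mulSeries (μ ν : MeanOneLaw) :
    (sEquiv.symm ((sEquiv μ).mulSeries (sEquiv ν))).1 = freeMulConv μ.1 ν.1 := by
  obtain ⟨μ, hμ⟩ := μ
  obtain ⟨ν, hν⟩ := ν
  obtain ⟨A, _, _, P, a, b, h, rfl, rfl⟩ := exists_isFreePair μ ν
  have hmean {c : A} (hc : (P.law c).toLin Polynomial.X = 1) : P.φ c = 1 := by
    simpa [NCProb.law] using hc
  refine Eq.trans (Law.ext_moment fun n => ?_) h.law_mul
  have hm := congrArg (coeff n) (h.momentSeries_mul (hmean hμ) (hmean hν))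
  rw [momentSeries, coeff_mk] at hm
  refine (Law.moment_ofMoments _ (if_pos rfl) n).trans ?_
  split_ifs at hm ⊢ with hn
  · rw [hn, Law.moment_zero]
  · exact hm.symm

theorem zdLogEquiv_symm_add (f g : Lam) :
    zdLogEquiv.symm (zdLogEquiv f + zdLogEquiv g) = f.mulSeries g := by
  rw [Equiv.symm_apply_eq]
  exact (zdLog_mulSeries f g).symm

end FreeProb
end

/-! ### Assembly of the theorem -/

open FreeProb
theorem mainTheorem1 :
    -- Every pair of laws is realised by free random variables, and the laws of the sum and of the
    -- product of free random variables are the free convolutions of their laws.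
    (∀ μ ν : Law, ∃ (A : Type) (_ : Ring A) (_ : Algebra ℂ A) (P : NCProb A) (a b : A),
      P.IsFreePair a b ∧ P.law a = μ ∧ P.law b = ν) ∧
    (∀ (A : Type*) [Ring A] [Algebra ℂ A] (P : NCProb A) (a b : A), P.IsFreePair a b →
      P.law (a + b) = freeAddConv (P.law a) (P.law b) ∧
      P.law (a * b) = freeMulConv (P.law a) (P.law b)) ∧
    -- Finite factorisations modulo `zⁿ⁺¹` exist, and they compute `f ∗ g` modulo `zⁿ⁺¹`.
    (∀ (n : ℕ) (f : Lam), ∃ s : Multiset ℂ, trunc (n + 1) f.1 = trunc (n + 1) (eulerProd s)) ∧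
    (∀ (n : ℕ) (f g : Lam) (s t : Multiset ℂ),
      trunc (n + 1) f.1 = trunc (n + 1) (eulerProd s) →
      trunc (n + 1) g.1 = trunc (n + 1) (eulerProd t) →
      trunc (n + 1) (Lam.star f g).1 = trunc (n + 1) (eulerProd (pairProducts s t))) ∧
    ∃ (_ : CommRing Lam) (_ : CommRing MeanOneLaw) (_ : CommRing Law),
      -- The ring `(Λ(ℂ), ·, ∗)`.
      (∀ f g : Lam, (f + g).1 = f.1 * g.1) ∧ (∀ f g : Lam, f * g = Lam.star f g) ∧
      -- The ring `(Σ₁ˣ, ⊠, ⊛)`.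
      (∀ μ ν : MeanOneLaw, (μ + ν).1 = freeMulConv μ.1 ν.1) ∧
      (∀ μ ν : MeanOneLaw, μ * ν = starConv μ ν) ∧
      -- The ring `(Σ, ⊞, ⊡)`.
      (∀ μ ν : Law, μ + ν = freeAddConv μ ν) ∧ (∀ μ ν : Law, μ * ν = dotConv μ ν) ∧
      -- The isomorphisms `S`, `R`, and `LOG` with inverse `EXP`.
      (∃ e : MeanOneLaw ≃+* Lam, ∀ μ, e μ = sEquiv μ) ∧
      (∃ e : Law ≃+* Ghost, ∀ μ, e μ = rEquiv μ) ∧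
      (∃ e : MeanOneLaw ≃+* Law, (∀ μ, e μ = LOG μ) ∧ (∀ ν, e.symm ν = EXP ν)) := by
  refine ⟨exists_isFreePair, fun A _ _ P a b h => ⟨h.law_add, h.law_mul⟩,
    exists_trunc_eq_eulerProd, fun n f g s t => trunc_star, ?_⟩
  -- With these structures z(d/dz)log, S and R are ring isomorphisms by construction, and `LOG` is a
  -- composite of them and R⁻¹. It remains to identify the transported operations.
  let _ : CommRing Lam := zdLogEquiv.commRing
  let _ : CommRing MeanOneLaw := sEquiv.commRing
  let _ : CommRing Law := rEquiv.commRing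
  have hadd (f g : Lam) : f + g = f.mulSeries g := zdLogEquiv_symm_add f g
  let eS : MeanOneLaw ≃+* Lam := sEquiv.ringEquiv
  let eR : Law ≃+* Ghost := rEquiv.ringEquiv
  let eL : Lam ≃+* Ghost := zdLogEquiv.ringEquiv
  refine ⟨inferInstance, inferInstance, inferInstance, fun f g => ?_, fun f g => ?_,
    fun μ ν => ?_, fun μ ν => ?_, fun μ ν => ?_, fun μ ν => rfl, ⟨eS, fun _ => rfl⟩,
    ⟨eR, fun _ => rfl⟩, ⟨eS.trans (eL.trans eR.symm), fun _ => rfl, fun _ => rfl⟩⟩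
  · rw [hadd]
    rfl
  · exact (star_eq_zdExp f g).symm
  · rw [← sEquiv_symm_mulSeries, ← hadd]
    rfl
  · exact congrArg sEquiv.symm (star_eq_zdExp _ _).symm
  · exact rEquiv.symm_apply_eq.2 (rEquiv_freeAddConv μ ν).symm
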